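/- Let $(\omega_n)_{n\in\mathbb Z^d}$ be independent, identically distributed real random variables on a probability space, whose common distribution has a bounded, compactly supported density $\rho\ge 0$ on $\mathbb R$. Write $|k|=|k_1|+\dots+|k_d|$ for $k\in\mathbb Z^d$, let $(e_x)_{x\in\mathbb Z^d}$ be the canonical basis of $\ell^2(\mathbb Z^d)$, and let $h=h_\omega$ be the Anderson Hamiltonian on $\ell^2(\mathbb Z^d)$, $$(hu)(n)=-\sum_{|k|=1}u(n+k)+\omega_n u(n),$$ which is almost surely a bounded self-adjoint operator. Let $G(x,y;z)=\langle e_x,(h-z)^{-1}e_y\rangle$ for $z\in\mathbb C\setminus\mathbb R$, and let $\mu_{x,y}(B)=\langle e_x,\chi_B(h)e_y\rangle$ ($B\subset\mathbb R$ Borel) be the mixed spectral measures of $h$, with total variation $|\mu_{x,y}|$. Let $I\subset\mathbb R$ be a bounded open interval, and suppose that there are $s\in(0,1)$, $C<\infty$ and $\mu>0$ such that $$\mathbb E\big(|G(x,y;E+i\varepsilon)|^s\big)\le C e^{-\mu|x-y|}\qquad\text{for all }x,y\in\mathbb Z^d,\ E\in I,\ \varepsilon>0.$$ Then: 1. (Dynamical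 localization in $I$.) There are constants $C'<\infty$ and $\mu'>0$ such that for all $x,y\in\mathbb Z^d$ $$\mathbb E\Big(\sup_{t\in\mathbb R}|\langle e_x,e^{-ith}\chi_I(h)e_y\rangle|\Big)\le C'e^{-\mu'|x-y|}.$$ 2. There are constants $C''<\infty$ and $\mu''>0$ such that for all $x,y\in\mathbb Z^d$ $$\mathbb E\big(|\mu_{x,y}|(I)\big)=\mathbb E\Big(\sup_{g:\mathbb R\to\mathbb C\ \text{Borel},\ |g|\le1}|\langle e_x,g(h)\chi_I(h)e_y\rangle|\Big)\le C''e^{-\mu''|x-y|}.$$ (All random variables under the expectations in 1 and 2 are measurable with respect to the completed probability space.) -/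

import Mathlib

open MeasureTheory ProbabilityTheory
open scoped ENNReal CompactlySupported

noncomputable section

/-! ### Spectral measures and Borel functional calculus of a bounded self-adjoint operator -/

section FunctionalCalculus

variable {H : Type*} [NormedAddCommGroup H] [InnerProductSpace ℂ H] [CompleteSpace H]

/-- The positive linear functional `f ↦ ⟨ψ, f(a) ψ⟩` on `C_c(ℝ)`, where `f(a)` is the continuous
functional calculus of the (self-adjoint) operator `a`. -/
def spectralFunctional (a : H →L[ℂ] H) (ψ : H) : C_c(ℝ, ℝ) →ₚ[ℝ] ℝ where
  toFun f := (inner ℂ ψ (cfc (fun r => f r) a ψ)).re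
  map_add' f g := by
    have h : cfc (fun r => (f + g) r) a = cfc (fun r => f r) a + cfc (fun r => g r) a :=
      cfc_add (R := ℝ) (fun r => f r) (fun r => g r) (a := a)
        (f.continuous.continuousOn) (g.continuous.continuousOn)
    rw [h]
    simp
  map_smul' c f := by
    have h : cfc (fun r => (c • f) r) a = c • cfc (fun r => f r) a :=
      cfc_smul (R := ℝ) c (fun r => f r) (a := a) (f.continuous.continuousOn)
    rw [h]
    simp [inner_smul_right_eq_smul]
  monotone' f g hfg := by
    have h : cfc (fun r => f r) a ≤ cfc (fun r => g r) a :=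
      cfc_mono (fun r _ => hfg r) (f.continuous.continuousOn) (g.continuous.continuousOn)
    have h2 := (ContinuousLinearMap.le_def _ _).1 h
    have h3 := h2.re_inner_nonneg_right ψ
    simp only [sub_apply, inner_sub_right] at h3
    simpa using h3

/-- The spectral measure `μ_ψ` of `a` at the vector `ψ`: the Borel measure on `ℝ` with
`∫ f dμ_ψ = ⟨ψ, f(a) ψ⟩` for all `f ∈ C_c(ℝ)`. -/
def spectralMeasure (a : H →L[ℂ] H) (ψ : H) : Measure ℝ :=
  RealRMK.rieszMeasure (spectralFunctional a ψ)

theorem integral_spectralMeasure (a : H →L[ℂ] H) (ψ : H) (f : C_c(ℝ, ℝ)) :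
    ∫ r, f r ∂(spectralMeasure a ψ) = (inner ℂ ψ (cfc (fun r => f r) a ψ)).re :=
  RealRMK.integral_rieszMeasure (spectralFunctional a ψ) f

theorem spectralFunctional_le (a : H →L[ℂ] H) (ψ : H) (f : C_c(ℝ, ℝ)) (hf : ∀ r, ‖f r‖ ≤ 1) :
    spectralFunctional a ψ f ≤ ‖ψ‖ ^ 2 := by
  have h : ‖cfc (fun r => f r) a‖ ≤ 1 := norm_cfc_le zero_le_one (fun r _ => hf r)
  change (inner ℂ ψ (cfc (fun r => f r) a ψ)).re ≤ _
  calc _ ≤ ‖inner ℂ ψ (cfc (fun r => f r) a ψ)‖ := Complex.re_le_norm _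
    _ ≤ ‖ψ‖ * ‖cfc (fun r => f r) a ψ‖ := norm_inner_le_norm _ _
    _ ≤ ‖ψ‖ * (1 * ‖ψ‖) := by
        gcongr; exact ContinuousLinearMap.le_of_opNorm_le _ h _
    _ = ‖ψ‖ ^ 2 := by ring

instance (a : H →L[ℂ] H) (ψ : H) : (spectralMeasure a ψ).Regular :=
  RealRMK.regular_rieszMeasure _

theorem spectralMeasure_univ_le (a : H →L[ℂ] H) (ψ : H) :
    spectralMeasure a ψ Set.univ ≤ ENNReal.ofReal (‖ψ‖ ^ 2) := by
  rw [isOpen_univ.measure_eq_iSup_isCompact (spectralMeasure a ψ)]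
  · refine iSup_le fun K => iSup_le fun _ => iSup_le fun hK => ?_
    obtain ⟨f, hf1, hf2, hf3⟩ :=
      exists_continuousMap_one_of_isCompact_subset_isOpen hK isOpen_univ (Set.subset_univ K)
    let F : C_c(ℝ, ℝ) := ⟨f, hf2⟩
    refine (RealRMK.rieszMeasure_le_of_eq_one (spectralFunctional a ψ) (f := F)
      (fun r => (hf3.2 r).1) hK (fun r hr => hf1 hr)).trans ?_
    refine ENNReal.ofReal_le_ofReal (spectralFunctional_le a ψ F fun r => ?_)
    have h := hf3.2 r
    rw [Real.norm_eq_abs, abs_le]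
    exact ⟨by have := h.1; change -1 ≤ f r; linarith, h.2⟩

instance (a : H →L[ℂ] H) (ψ : H) : IsFiniteMeasure (spectralMeasure a ψ) :=
  ⟨(spectralMeasure_univ_le a ψ).trans_lt ENNReal.ofReal_lt_top⟩

theorem integrable_spectralMeasure (a : H →L[ℂ] H) (ψ : H) {g : ℝ → ℂ} (hg : Measurable g)
    {M : ℝ} (hM : ∀ r, ‖g r‖ ≤ M) : Integrable g (spectralMeasure a ψ) :=
  Integrable.of_bound hg.aestronglyMeasurable M (Filter.Eventually.of_forall hM)

theorem norm_integral_spectralMeasure_le (a : H →L[ℂ] H) (ψ : H) {g : ℝ → ℂ}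
    {M : ℝ} (hM0 : 0 ≤ M) (hM : ∀ r, ‖g r‖ ≤ M) :
    ‖∫ r, g r ∂(spectralMeasure a ψ)‖ ≤ M * ‖ψ‖ ^ 2 := by
  refine (norm_integral_le_of_norm_le_const (Filter.Eventually.of_forall hM)).trans ?_
  gcongr
  exact ENNReal.toReal_le_of_le_ofReal (by positivity) (spectralMeasure_univ_le a ψ)

/-- A real linear relation between spectral measures, tested on `C_c(ℝ)`, holds for all bounded
Borel functions. -/
theorem sum_integral_spectralMeasure_eq_zero_of_real (a : H →L[ℂ] H) (s : Finset H) (c : H → ℝ)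
    (h : ∀ f : C_c(ℝ, ℝ), ∑ v ∈ s, c v * ∫ r, f r ∂(spectralMeasure a v) = 0)
    {g : ℝ → ℂ} (hg : Measurable g) {M : ℝ} (hM : ∀ r, ‖g r‖ ≤ M) :
    ∑ v ∈ s, (c v : ℂ) * ∫ r, g r ∂(spectralMeasure a v) = 0 := by
  have hc : ∀ v, c v = (c v).toNNReal - (-c v).toNNReal := fun v => by
    simp only [Real.coe_toNNReal', max_zero_sub_max_neg_zero_eq_self]
  let μp : Measure ℝ := ∑ v ∈ s, (c v).toNNReal • spectralMeasure a v
  let μm : Measure ℝ := ∑ v ∈ s, (-c v).toNNReal • spectralMeasure a v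
  have hint : ∀ (d : H → NNReal) (G : ℝ → ℂ), (∀ v, Integrable G (spectralMeasure a v)) →
      ∫ r, G r ∂(∑ v ∈ s, d v • spectralMeasure a v)
        = ∑ v ∈ s, (d v : ℂ) * ∫ r, G r ∂(spectralMeasure a v) := by
    intro d G hG
    rw [integral_finsetSum_measure (fun v _ => (hG v).smul_measure_nnreal)]
    refine Finset.sum_congr rfl fun v _ => ?_
    rw [integral_smul_nnreal_measure]
    rfl
  have hintR : ∀ (d : H → NNReal) (G : ℝ → ℝ), (∀ v, Integrable G (spectralMeasure a v)) →
      ∫ r, G r ∂(∑ v ∈ s, d v • spectralMeasure a v)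
        = ∑ v ∈ s, (d v : ℝ) * ∫ r, G r ∂(spectralMeasure a v) := by
    intro d G hG
    rw [integral_finsetSum_measure (fun v _ => (hG v).smul_measure_nnreal)]
    refine Finset.sum_congr rfl fun v _ => ?_
    rw [integral_smul_nnreal_measure]
    rfl
  have hμ : μp = μm := by
    have : IsFiniteMeasure μp := by dsimp only [μp]; infer_instance
    have : IsFiniteMeasure μm := by dsimp only [μm]; infer_instance
    refine Measure.ext_of_integral_eq_on_compactlySupported fun f => ?_
    dsimp only [μp, μm]
    rw [hintR _ _ fun v => f.integrable, hintR _ _ fun v => f.integrable, ← sub_eq_zero,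
      ← Finset.sum_sub_distrib, ← h f]
    refine Finset.sum_congr rfl fun v _ => ?_
    rw [← sub_mul, ← hc v]
  have e1 := hint (fun v => (c v).toNNReal) g fun v => integrable_spectralMeasure a v hg hM
  have e2 := hint (fun v => (-c v).toNNReal) g fun v => integrable_spectralMeasure a v hg hM
  have e3 : ∫ r, g r ∂μp = ∫ r, g r ∂μm := by rw [hμ]
  dsimp only [μp, μm] at e3
  rw [e1, e2, ← sub_eq_zero, ← Finset.sum_sub_distrib] at e3
  rw [← e3]
  refine Finset.sum_congr rfl fun v _ => ?_
  rw [← sub_mul]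
  congr 1
  exact_mod_cast congrArg (fun t : ℝ => (t : ℂ)) (hc v)

/-- A linear relation between quadratic forms `v ↦ ⟨v, T v⟩` that holds for all operators `T`
holds for the forms `v ↦ ∫ g dμ_v`. -/
theorem linearCombination_integral_eq_zero (a : H →L[ℂ] H) (x : H →₀ ℂ)
    (h : ∀ T : H →L[ℂ] H, Finsupp.linearCombination ℂ (fun v => inner ℂ v (T v)) x = 0)
    {g : ℝ → ℂ} (hg : Measurable g) {M : ℝ} (hM : ∀ r, ‖g r‖ ≤ M) :
    Finsupp.linearCombination ℂ (fun v => ∫ r, g r ∂(spectralMeasure a v)) x = 0 := by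
  have hreal : ∀ (f : C_c(ℝ, ℝ)) (v : H), inner ℂ v (cfc (fun r => f r) a v)
      = ((∫ r, f r ∂(spectralMeasure a v) : ℝ) : ℂ) := by
    intro f v
    rw [integral_spectralMeasure]
    have hsa : IsSelfAdjoint (cfc (fun r => f r) a) := cfc_predicate _ _
    exact (hsa.isSymmetric.coe_re_inner_self_apply v).symm
  have hsum : ∀ f : C_c(ℝ, ℝ),
      ∑ v ∈ x.support, x v * ((∫ r, f r ∂(spectralMeasure a v) : ℝ) : ℂ) = 0 := by
    intro f
    have := h (cfc (fun r => f r) a)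
    rw [Finsupp.linearCombination_apply, Finsupp.sum] at this
    rw [← this]
    exact Finset.sum_congr rfl fun v _ => by rw [hreal, smul_eq_mul]
  have h1 := sum_integral_spectralMeasure_eq_zero_of_real a x.support (fun v => (x v).re)
    (fun f => by simpa using congrArg Complex.re (hsum f)) hg hM
  have h2 := sum_integral_spectralMeasure_eq_zero_of_real a x.support (fun v => (x v).im)
    (fun f => by simpa using congrArg Complex.im (hsum f)) hg hM
  rw [Finsupp.linearCombination_apply, Finsupp.sum]
  calc _ = ∑ v ∈ x.support, (((x v).re : ℂ) * ∫ r, g r ∂(spectralMeasure a v)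
            + Complex.I * (((x v).im : ℂ) * ∫ r, g r ∂(spectralMeasure a v))) := by
          refine Finset.sum_congr rfl fun v _ => ?_
          conv_lhs => rw [smul_eq_mul, ← Complex.re_add_im (x v)]
          ring
    _ = 0 := by rw [Finset.sum_add_distrib, ← Finset.mul_sum, h1, h2]; simp

/-- The polarization of a pair of vectors, as a formal linear combination of vectors. -/
def polarization (φ ψ : H) : H →₀ ℂ :=
  (1 / 4 : ℂ) • (Finsupp.single (φ + ψ) 1 - Finsupp.single (φ - ψ) 1
    - Finsupp.single (φ + Complex.I • ψ) Complex.I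
    + Finsupp.single (φ - Complex.I • ψ) Complex.I)

theorem linearCombination_polarization (T : H →L[ℂ] H) (φ ψ : H) :
    Finsupp.linearCombination ℂ (fun v => inner ℂ v (T v)) (polarization φ ψ)
      = inner ℂ φ (T ψ) := by
  simp only [polarization, map_smul, map_add, map_sub, Finsupp.linearCombination_single,
    inner_add_left, inner_add_right, inner_sub_left, inner_sub_right, inner_smul_left,
    inner_smul_right, smul_eq_mul, Complex.conj_I]
  ring_nf
  simp only [Complex.I_sq]
  ring

theorem linearCombination_integral_eq (a : H →L[ℂ] H) (x y : H →₀ ℂ)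
    (h : ∀ T : H →L[ℂ] H, Finsupp.linearCombination ℂ (fun v => inner ℂ v (T v)) x
      = Finsupp.linearCombination ℂ (fun v => inner ℂ v (T v)) y)
    {g : ℝ → ℂ} (hg : Measurable g) {M : ℝ} (hM : ∀ r, ‖g r‖ ≤ M) :
    Finsupp.linearCombination ℂ (fun v => ∫ r, g r ∂(spectralMeasure a v)) x
      = Finsupp.linearCombination ℂ (fun v => ∫ r, g r ∂(spectralMeasure a v)) y := by
  rw [← sub_eq_zero, ← map_sub]
  refine linearCombination_integral_eq_zero a _ (fun T => ?_) hg hM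
  rw [map_sub, h T, sub_self]

theorem norm_linearCombination_polarization_le (a : H →L[ℂ] H) {g : ℝ → ℂ} {M : ℝ}
    (hM0 : 0 ≤ M) (hM : ∀ r, ‖g r‖ ≤ M) (φ ψ : H) :
    ‖Finsupp.linearCombination ℂ (fun v => ∫ r, g r ∂(spectralMeasure a v)) (polarization φ ψ)‖
      ≤ M * (‖φ‖ + ‖ψ‖) ^ 2 := by
  have key : ∀ w : H, ‖w‖ ≤ ‖φ‖ + ‖ψ‖ →
      ‖∫ r, g r ∂(spectralMeasure a w)‖ ≤ M * (‖φ‖ + ‖ψ‖) ^ 2 := fun w hw =>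
    (norm_integral_spectralMeasure_le a w hM0 hM).trans (by gcongr)
  have k1 := key (φ + ψ) (norm_add_le _ _)
  have k2 := key (φ - ψ) (norm_sub_le _ _)
  have k3 := key (φ + Complex.I • ψ) ((norm_add_le _ _).trans (by simp [norm_smul]))
  have k4 := key (φ - Complex.I • ψ) ((norm_sub_le _ _).trans (by simp [norm_smul]))
  simp only [polarization, map_smul, map_add, map_sub, Finsupp.linearCombination_single,
    smul_eq_mul, one_mul]
  rw [norm_mul]
  have e : ‖(1 / 4 : ℂ)‖ = 1 / 4 := by norm_num
  rw [e]
  have k3' : ‖Complex.I * ∫ r, g r ∂(spectralMeasure a (φ + Complex.I • ψ))‖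
      ≤ M * (‖φ‖ + ‖ψ‖) ^ 2 := by rw [norm_mul, Complex.norm_I, one_mul]; exact k3
  have k4' : ‖Complex.I * ∫ r, g r ∂(spectralMeasure a (φ - Complex.I • ψ))‖
      ≤ M * (‖φ‖ + ‖ψ‖) ^ 2 := by rw [norm_mul, Complex.norm_I, one_mul]; exact k4
  have := norm_add_le_of_le (norm_sub_le_of_le (norm_sub_le_of_le k1 k2) k3') k4'
  linarith

/-- For a bounded Borel function `g` there is exactly one bounded operator `T` with
`⟨ψ, T ψ⟩ = ∫ g dμ_ψ` for all `ψ`. -/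
theorem existsUnique_borelCalculus (a : H →L[ℂ] H) {g : ℝ → ℂ} (hg : Measurable g)
    {M : ℝ} (hM : ∀ r, ‖g r‖ ≤ M) :
    ∃! T : H →L[ℂ] H, ∀ ψ, inner ℂ ψ (T ψ) = ∫ r, g r ∂(spectralMeasure a ψ) := by
  have hM0 : 0 ≤ M := (norm_nonneg _).trans (hM 0)
  let L := Finsupp.linearCombination ℂ (fun v => ∫ r, g r ∂(spectralMeasure a v))
  have hL : ∀ x y : H →₀ ℂ, (∀ T : H →L[ℂ] H,
      Finsupp.linearCombination ℂ (fun v => inner ℂ v (T v)) x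
      = Finsupp.linearCombination ℂ (fun v => inner ℂ v (T v)) y) → L x = L y :=
    fun x y h => linearCombination_integral_eq a x y h hg hM
  have smul_r : ∀ (c : ℂ) φ ψ, L (polarization φ (c • ψ)) = c * L (polarization φ ψ) := by
    intro c φ ψ
    rw [← smul_eq_mul, ← map_smul]
    refine hL _ _ fun T => ?_
    simp [linearCombination_polarization]
  have smul_l : ∀ (c : ℂ) φ ψ,
      L (polarization (c • φ) ψ) = (starRingEnd ℂ) c * L (polarization φ ψ) := by
    intro c φ ψ
    rw [← smul_eq_mul, ← map_smul]
    refine hL _ _ fun T => ?_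
    simp [linearCombination_polarization, mul_comm]
  let B : H →ₗ⋆[ℂ] H →ₗ[ℂ] ℂ := LinearMap.mk₂'ₛₗ (starRingEnd ℂ) (RingHom.id ℂ)
    (fun φ ψ => L (polarization φ ψ))
    (fun φ φ' ψ => by
      rw [← map_add]
      refine hL _ _ fun T => ?_
      simp [linearCombination_polarization])
    (fun c φ ψ => by rw [smul_l, smul_eq_mul])
    (fun φ ψ ψ' => by
      rw [← map_add]
      refine hL _ _ fun T => ?_
      simp [linearCombination_polarization])
    (fun c φ ψ => by rw [smul_r]; rfl)
  have hB : ∀ φ ψ, ‖B φ ψ‖ ≤ 4 * M * ‖φ‖ * ‖ψ‖ := by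
    intro φ ψ
    rcases eq_or_ne φ 0 with rfl | hφ
    · simp
    rcases eq_or_ne ψ 0 with rfl | hψ
    · simp
    have hφ' : (0 : ℝ) < ‖φ‖ := norm_pos_iff.2 hφ
    have hψ' : (0 : ℝ) < ‖ψ‖ := norm_pos_iff.2 hψ
    have h1 := norm_linearCombination_polarization_le a hM0 hM
      (((‖φ‖⁻¹ : ℝ) : ℂ) • φ) (((‖ψ‖⁻¹ : ℝ) : ℂ) • ψ)
    have n1 : ‖((‖φ‖⁻¹ : ℝ) : ℂ) • φ‖ = 1 := by
      rw [norm_smul]; simp [hφ'.ne']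
    have n2 : ‖((‖ψ‖⁻¹ : ℝ) : ℂ) • ψ‖ = 1 := by
      rw [norm_smul]; simp [hψ'.ne']
    rw [n1, n2] at h1
    change ‖L _‖ ≤ _ at h1
    rw [smul_l, smul_r] at h1
    change ‖L (polarization φ ψ)‖ ≤ _
    simp only [norm_mul, RCLike.norm_conj, Complex.norm_real, norm_inv, norm_norm] at h1
    rw [← mul_assoc, ← mul_inv, inv_mul_le_iff₀ (by positivity)] at h1
    linarith
  let Bc : H →L⋆[ℂ] H →L[ℂ] ℂ := LinearMap.mkContinuous₂ B (4 * M) hB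
  have hT : ∀ φ ψ, inner ℂ φ ((InnerProductSpace.continuousLinearMapOfBilin Bc).adjoint ψ)
      = L (polarization φ ψ) := by
    intro φ ψ
    rw [ContinuousLinearMap.adjoint_inner_right, InnerProductSpace.continuousLinearMapOfBilin_apply]
    rfl
  refine ⟨(InnerProductSpace.continuousLinearMapOfBilin Bc).adjoint, fun ψ => ?_, fun T hT' => ?_⟩
  · rw [hT]
    have : L (polarization ψ ψ) = L (Finsupp.single ψ 1) := hL _ _ fun T => by
      simp [linearCombination_polarization]
    rw [this]
    simp [L]
  · ext ψ
    refine ext_inner_left ℂ fun φ => ?_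
    rw [hT, ← linearCombination_polarization T φ ψ]
    simp only [hT']
    rfl

open Classical in
/-- The Borel functional calculus: for a bounded self-adjoint operator `a` and a bounded Borel
function `g`, the operator `g(a)` is the bounded operator determined by
`⟨ψ, g(a) ψ⟩ = ∫ g dμ_ψ` for all vectors `ψ`. -/
def borelCalculus (a : H →L[ℂ] H) (g : ℝ → ℂ) : H →L[ℂ] H :=
  if h : ∃ T : H →L[ℂ] H, ∀ ψ, inner ℂ ψ (T ψ) = ∫ r, g r ∂(spectralMeasure a ψ) then
    h.choose
  else 0

theorem inner_borelCalculus_self (a : H →L[ℂ] H) {g : ℝ → ℂ} (hg : Measurable g)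
    {M : ℝ} (hM : ∀ r, ‖g r‖ ≤ M) (ψ : H) :
    inner ℂ ψ (borelCalculus a g ψ) = ∫ r, g r ∂(spectralMeasure a ψ) := by
  have h := (existsUnique_borelCalculus a hg hM).exists
  rw [borelCalculus, dif_pos h]
  exact h.choose_spec ψ

/-- The spectral projection `χ_B(a)`. -/
def spectralProjection (a : H →L[ℂ] H) (B : Set ℝ) : H →L[ℂ] H :=
  borelCalculus a (B.indicator 1)

theorem inner_spectralProjection_self (a : H →L[ℂ] H) {B : Set ℝ} (hB : MeasurableSet B) (ψ : H) :
    inner ℂ ψ (spectralProjection a B ψ) = ((spectralMeasure a ψ).real B : ℂ) := by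
  rw [spectralProjection, inner_borelCalculus_self a (measurable_one.indicator hB) (M := 1)]
  · rw [integral_indicator hB]
    simp
  · intro r
    by_cases h : r ∈ B <;> simp [h]

theorem inner_spectralProjection (a : H →L[ℂ] H) {B : Set ℝ} (hB : MeasurableSet B) (φ ψ : H) :
    inner ℂ φ (spectralProjection a B ψ) = Finsupp.linearCombination ℂ
      (fun v => ((spectralMeasure a v).real B : ℂ)) (polarization φ ψ) := by
  rw [← linearCombination_polarization]
  simp only [inner_spectralProjection_self a hB]

open Classical in
/-- The mixed spectral measure `μ_{φ,ψ}(B) = ⟨φ, χ_B(a) ψ⟩`, a complex Borel measure on `ℝ`. -/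
def mixedSpectralMeasure (a : H →L[ℂ] H) (φ ψ : H) : ComplexMeasure ℝ where
  measureOf' B := if MeasurableSet B then inner ℂ φ (spectralProjection a B ψ) else 0
  empty' := by
    simp [inner_spectralProjection a MeasurableSet.empty, Finsupp.linearCombination_apply]
  not_measurable' B hB := by simp [hB]
  m_iUnion' f hf hd := by
    simp only [hf, MeasurableSet.iUnion hf, if_true, inner_spectralProjection a (hf _),
      inner_spectralProjection a (MeasurableSet.iUnion hf), Finsupp.linearCombination_apply,
      Finsupp.sum]
    refine hasSum_sum fun v _ => ?_
    have h := (spectralMeasure a v).toSignedMeasure.m_iUnion hf hd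
    simp only [Measure.toSignedMeasure_apply_measurable (hf _),
      Measure.toSignedMeasure_apply_measurable (MeasurableSet.iUnion hf)] at h
    exact (Complex.hasSum_ofReal.2 h).const_smul _

end FunctionalCalculus

/-! ### The Anderson model -/

section AndersonModel

variable {d : ℕ}

/-- The distance `|x - y| = ∑ᵢ |xᵢ - yᵢ|` on `ℤ^d`. -/
def latticeDist (x y : Fin d → ℤ) : ℤ := ∑ i, |x i - y i|

/-- The lattice vectors `k` with `|k| = 1`. -/
def unitVectors (d : ℕ) : Finset (Fin d → ℤ) :=
  (Finset.Icc (fun _ => -1) (fun _ => 1)).filter fun k => ∑ i, |k i| = 1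

theorem mem_unitVectors (k : Fin d → ℤ) : k ∈ unitVectors d ↔ ∑ i, |k i| = 1 := by
  simp only [unitVectors, Finset.mem_filter, Finset.mem_Icc, and_iff_right_iff_imp]
  intro h
  have h1 : ∀ i, |k i| ≤ 1 := fun i => h ▸
    Finset.single_le_sum (f := fun i => |k i|) (fun j _ => abs_nonneg (k j)) (Finset.mem_univ i)
  exact ⟨fun i => (abs_le.1 (h1 i)).1, fun i => (abs_le.1 (h1 i)).2⟩

/-- The Hilbert space `ℓ²(ℤ^d)`. -/
abbrev LatticeL2 (d : ℕ) : Type := lp (fun _ : Fin d → ℤ => ℂ) 2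

/-- The canonical basis vector `e_x` of `ℓ²(ℤ^d)`. -/
def basisVector (x : Fin d → ℤ) : LatticeL2 d := lp.single 2 x 1

theorem memℓp_comp_add (u : LatticeL2 d) (k : Fin d → ℤ) :
    Memℓp (fun n : Fin d → ℤ => u (n + k)) 2 := by
  have h := lp.memℓp u
  rw [memℓp_gen_iff (by norm_num)] at h ⊢
  exact h.comp_injective (add_left_injective k)

/-- The translation `(S_k u)(n) = u(n + k)` on `ℓ²(ℤ^d)`. -/
def shift (k : Fin d → ℤ) : LatticeL2 d →L[ℂ] LatticeL2 d :=
  LinearMap.mkContinuous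
    { toFun u := ⟨fun n => u (n + k), memℓp_comp_add u k⟩
      map_add' _ _ := rfl
      map_smul' _ _ := rfl }
    1
    fun u => by
      rw [one_mul, lp.norm_eq_tsum_rpow (by norm_num), lp.norm_eq_tsum_rpow (by norm_num)]
      exact le_of_eq (congrArg (fun t : ℝ => t ^ (1 / (2 : ℝ≥0∞).toReal))
        ((Equiv.addRight k).tsum_eq fun n => ‖u n‖ ^ (2 : ℝ≥0∞).toReal))

/-- The discrete Laplacian `(h₀ u)(n) = - ∑_{|k| = 1} u(n + k)`. -/
def discreteLaplacian (d : ℕ) : LatticeL2 d →L[ℂ] LatticeL2 d :=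
  -∑ k ∈ unitVectors d, shift k

theorem discreteLaplacian_apply (u : LatticeL2 d) (n : Fin d → ℤ) :
    discreteLaplacian d u n = -∑ k ∈ unitVectors d, u (n + k) := by
  simp only [discreteLaplacian, neg_apply, _root_.sum_apply, lp.coeFn_neg, Pi.neg_apply,
    lp.coeFn_sum, Finset.sum_apply]
  rfl

open Classical in
/-- The multiplication operator `(V u)(n) = v(n) u(n)` by a bounded real potential `v`. For
unbounded `v` the value is a placeholder; under a compactly supported single-site distribution
the potential is almost surely bounded. -/
def potentialOperator (v : (Fin d → ℤ) → ℝ) : LatticeL2 d →L[ℂ] LatticeL2 d :=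
  if h : ∃ K : ℝ, 0 ≤ K ∧ ∀ n, |v n| ≤ K then
    lp.mapCLM 2 (fun n => (v n : ℂ) • ContinuousLinearMap.id ℂ ℂ) h.choose_spec.1 (fun n => by
      rw [norm_smul, ContinuousLinearMap.norm_id, mul_one, Complex.norm_real]
      exact h.choose_spec.2 n)
  else 0

theorem potentialOperator_apply (v : (Fin d → ℤ) → ℝ) {K : ℝ} (hK : ∀ n, |v n| ≤ K)
    (u : LatticeL2 d) (n : Fin d → ℤ) : potentialOperator v u n = v n * u n := by
  have h : ∃ K : ℝ, 0 ≤ K ∧ ∀ n, |v n| ≤ K := ⟨K, (abs_nonneg _).trans (hK 0), hK⟩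
  rw [potentialOperator, dif_pos h]
  simp

/-- The Anderson Hamiltonian `h = h₀ + V` for the potential `v`. -/
def andersonHamiltonian (v : (Fin d → ℤ) → ℝ) : LatticeL2 d →L[ℂ] LatticeL2 d :=
  discreteLaplacian d + potentialOperator v

/-- The Green function `G(x, y; z) = ⟨e_x, (h - z)⁻¹ e_y⟩`. -/
def greenFunction (v : (Fin d → ℤ) → ℝ) (x y : Fin d → ℤ) (z : ℂ) : ℂ :=
  inner ℂ (basisVector x)
    (Ring.inverse (andersonHamiltonian v - z • ContinuousLinearMap.id ℂ (LatticeL2 d))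
      (basisVector y))

/-- `sup_t |⟨e_x, e^{-ith} χ_I(h) e_y⟩|`. -/
def timeSupremum (v : (Fin d → ℤ) → ℝ) (I : Set ℝ) (x y : Fin d → ℤ) : ℝ≥0∞ :=
  ⨆ t : ℝ, ‖inner ℂ (basisVector x)
    (borelCalculus (andersonHamiltonian v) (fun r => Complex.exp (-Complex.I * t * r))
      (spectralProjection (andersonHamiltonian v) I (basisVector y)))‖ₑ

/-- `sup_g |⟨e_x, g(h) χ_I(h) e_y⟩|` over all Borel functions `g : ℝ → ℂ` with `|g| ≤ 1`. -/
def borelSupremum (v : (Fin d → ℤ) → ℝ) (I : Set ℝ) (x y : Fin d → ℤ) : ℝ≥0∞ :=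
  ⨆ g : {g : ℝ → ℂ // Measurable g ∧ ∀ r, ‖g r‖ ≤ 1}, ‖inner ℂ (basisVector x)
    (borelCalculus (andersonHamiltonian v) g
      (spectralProjection (andersonHamiltonian v) I (basisVector y)))‖ₑ

/-- The total variation `|μ_{x,y}|(I)` of the mixed spectral measure
`μ_{x,y}(B) = ⟨e_x, χ_B(h) e_y⟩`. -/
def spectralVariation (v : (Fin d → ℤ) → ℝ) (I : Set ℝ) (x y : Fin d → ℤ) : ℝ≥0∞ :=
  (mixedSpectralMeasure (andersonHamiltonian v) (basisVector x) (basisVector y)).variation I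

variable {Ω : Type*} [MeasurableSpace Ω]

/-- The nonnegative random variables `X x y` satisfy `𝔼(X x y) ≤ C e^{-m |x - y|}` for all
`x, y`, with constants `C < ∞` and `m > 0`. -/
def ExponentialDecay (P : Measure Ω) (X : (Fin d → ℤ) → (Fin d → ℤ) → Ω → ℝ≥0∞) : Prop :=
  ∃ C m : ℝ, 0 < m ∧ ∀ x y, AEMeasurable (X x y) P ∧
    ∫⁻ o, X x y o ∂P ≤ ENNReal.ofReal (C * Real.exp (-m * latticeDist x y))

/-- Dynamical localization in `I` of the Anderson model with random potential `ω`. -/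
def DynamicalLocalization (P : Measure Ω) (ω : (Fin d → ℤ) → Ω → ℝ) (I : Set ℝ) : Prop :=
  ExponentialDecay P fun x y o => timeSupremum (fun n => ω n o) I x y

end AndersonModel

end

/-!
The total variation `|μ_{x,y}|(I)` is controlled by the Green function near the real axis: for the
resolvent `R(z) = (h - z)⁻¹`, the Poisson kernel representation of `γ ⟨R(E + iγ)e_x, R(E + iγ)e_y⟩`
gives `|μ_{x,y}|(I) ≤ liminf_{γ → 0} γ ∫_I |⟨R(E + iγ)e_x, R(E + iγ)e_y⟩| dE`, and the integrand is
at most `∑_n |G(n,x)| |G(n,y)|`. By Cauchy-Schwarz it suffices that the second moments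
`γ 𝔼|G(n,x; E + iγ)|²` decay exponentially.

As a function of the potential `t` at the site `x` alone, rank-one perturbation theory gives
`|G(n,x)| = R / |t - w|` with `w` and `R` independent of `t` and `γ R² ≤ Im w`. Averaged over a
bounded, compactly supported density, `γ R² / |t - w|²` is thus bounded by a multiple of the
average of `(R / |t - w|)^s`, so the hypothesis on fractional moments bounds the second moments.
-/

noncomputable section

open Filter Topology
open scoped ComplexConjugate NNReal

section Approximation

variable {X E : Type*} [NormedAddCommGroup E] [NormedSpace ℝ E]

theorem exists_continuous_retraction_closedBall {M : ℝ} (hM : 0 ≤ M) :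
    ∃ c : C(E, E), (∀ z, ‖c z‖ ≤ M) ∧ ∀ z, ‖z‖ ≤ M → c z = z := by
  rcases hM.eq_or_lt with rfl | hM
  · exact ⟨0, fun z => by simp, fun z hz => (norm_le_zero_iff.1 hz).symm⟩
  have hpos : ∀ z : E, 0 < max M ‖z‖ := fun z => hM.trans_le (le_max_left _ _)
  refine ⟨⟨fun z => (M / max M ‖z‖) • z, ?_⟩, fun z => ?_, fun z hz => ?_⟩
  · exact (continuous_const.div (by fun_prop) fun z => (hpos z).ne').smul continuous_id
  · rw [ContinuousMap.coe_mk, norm_smul, Real.norm_of_nonneg (by positivity), div_mul_eq_mul_div,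
      div_le_iff₀ (hpos z)]
    gcongr
    exact le_max_right _ _
  · simp [max_eq_left hz, hM.ne']

theorem exists_continuous_seq_tendsto_ae [TopologicalSpace X] [NormalSpace X] [MeasurableSpace X]
    [BorelSpace X] [SecondCountableTopologyEither X E] (ν : Measure X) [IsFiniteMeasure ν]
    [ν.WeaklyRegular] {g : X → E} (hg : AEStronglyMeasurable g ν) {M : ℝ} (hM : 0 ≤ M)
    (hgM : ∀ r, ‖g r‖ ≤ M) :
    ∃ F : ℕ → C(X, E), (∀ n r, ‖F n r‖ ≤ M) ∧
      ∀ᵐ r ∂ν, Tendsto (fun n => F n r) atTop (𝓝 (g r)) := by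
  have hmem : MemLp g 1 ν := .of_bound hg M (.of_forall hgM)
  obtain ⟨δ, -, hδ_pos, hδ⟩ := exists_seq_strictAnti_tendsto' (zero_lt_one' ℝ≥0∞)
  choose f hf _ using fun n =>
    hmem.exists_boundedContinuous_eLpNorm_sub_le ENNReal.one_ne_top (hδ_pos n).1.ne'
  have hL1 : Tendsto (fun n => eLpNorm (⇑(f n) - g) 1 ν) atTop (𝓝 0) :=
    tendsto_of_tendsto_of_tendsto_of_le_of_le tendsto_const_nhds hδ (fun _ => bot_le)
      fun n => (eLpNorm_sub_comm _ _ _ _).trans_le (hf n)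
  obtain ⟨k, -, hk⟩ := (tendstoInMeasure_of_tendsto_eLpNorm one_ne_zero
    (fun n => (f n).continuous.aestronglyMeasurable) hg hL1).exists_seq_tendsto_ae
  obtain ⟨c, hcM, hc⟩ := exists_continuous_retraction_closedBall (E := E) hM
  refine ⟨fun n => c.comp (f (k n)), fun n r => hcM _, ?_⟩
  filter_upwards [hk] with r hr
  simpa only [hc _ (hgM r)] using! (c.continuous.tendsto (g r)).comp hr

end Approximation

/-- `g` is a Borel function with `|g| ≤ M`. The bound is a parameter because dominated convergence
needs one bound for a whole family of functions. -/
structure IsBoundedBorel (g : ℝ → ℂ) (M : ℝ) : Prop where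
  measurable : Measurable g
  norm_le : ∀ r, ‖g r‖ ≤ M

namespace IsBoundedBorel

variable {f g : ℝ → ℂ} {M N : ℝ}

theorem nonneg (hg : IsBoundedBorel g M) : 0 ≤ M := (norm_nonneg _).trans (hg.norm_le 0)

theorem add (hf : IsBoundedBorel f M) (hg : IsBoundedBorel g N) :
    IsBoundedBorel (fun r => f r + g r) (M + N) :=
  ⟨hf.measurable.add hg.measurable, fun r => norm_add_le_of_le (hf.norm_le r) (hg.norm_le r)⟩

theorem mul (hf : IsBoundedBorel f M) (hg : IsBoundedBorel g N) :
    IsBoundedBorel (fun r => f r * g r) (M * N) :=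
  ⟨hf.measurable.mul hg.measurable, fun r =>
    (norm_mul_le _ _).trans (mul_le_mul (hf.norm_le r) (hg.norm_le r) (norm_nonneg _) hf.nonneg)⟩

theorem const (c : ℂ) : IsBoundedBorel (fun _ => c) ‖c‖ := ⟨measurable_const, fun _ => le_rfl⟩

theorem star (hg : IsBoundedBorel g M) : IsBoundedBorel (fun r => conj (g r)) M :=
  ⟨Complex.continuous_conj.measurable.comp hg.measurable, by simpa using hg.norm_le⟩

theorem indicator_one {B : Set ℝ} (hB : MeasurableSet B) :
    IsBoundedBorel (B.indicator 1) 1 :=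
  ⟨measurable_one.indicator hB, fun r => (norm_indicator_le_norm_self _ r).trans (by simp)⟩

end IsBoundedBorel

section BorelCalculus

variable {H : Type*} [NormedAddCommGroup H] [InnerProductSpace ℂ H] [CompleteSpace H]
  (a : H →L[ℂ] H) {f g : ℝ → ℂ} {M N : ℝ}

theorem borelCalculus_eq_of_forall_inner (hg : IsBoundedBorel g M) {T : H →L[ℂ] H}
    (hT : ∀ ψ, inner ℂ ψ (T ψ) = ∫ r, g r ∂(spectralMeasure a ψ)) : borelCalculus a g = T :=
  (existsUnique_borelCalculus a hg.measurable hg.norm_le).unique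
    (inner_borelCalculus_self a hg.measurable hg.norm_le) hT

theorem inner_borelCalculus (hg : IsBoundedBorel g M) (φ ψ : H) :
    inner ℂ φ (borelCalculus a g ψ) = Finsupp.linearCombination ℂ
      (fun v => ∫ r, g r ∂(spectralMeasure a v)) (polarization φ ψ) := by
  simp only [← linearCombination_polarization,
    inner_borelCalculus_self a hg.measurable hg.norm_le]

theorem tendsto_inner_borelCalculus {ι : Type*} {l : Filter ι} [l.IsCountablyGenerated]
    {F : ι → ℝ → ℂ} (hF : ∀ i, IsBoundedBorel (F i) M) (hg : IsBoundedBorel g N) (φ ψ : H)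
    (h : ∀ v ∈ (polarization φ ψ).support, ∀ᵐ r ∂(spectralMeasure a v),
      Tendsto (fun i => F i r) l (𝓝 (g r))) :
    Tendsto (fun i => inner ℂ φ (borelCalculus a (F i) ψ)) l
      (𝓝 (inner ℂ φ (borelCalculus a g ψ))) := by
  simp only [inner_borelCalculus a (hF _), inner_borelCalculus a hg,
    Finsupp.linearCombination_apply, Finsupp.sum]
  exact tendsto_finsetSum _ fun v hv => (tendsto_integral_filter_of_dominated_convergence
    (fun _ => M) (.of_forall fun i => (hF i).measurable.aestronglyMeasurable)
    (.of_forall fun i => .of_forall (hF i).norm_le) (integrable_const _) (h v hv)).const_smul _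

theorem continuous_inner_borelCalculus {X : Type*} [TopologicalSpace X] [FirstCountableTopology X]
    {F : X → ℝ → ℂ} (hF : ∀ x, IsBoundedBorel (F x) M) (h : ∀ r, Continuous fun x => F x r)
    (φ ψ : H) : Continuous fun x => inner ℂ φ (borelCalculus a (F x) ψ) :=
  continuous_iff_continuousAt.2 fun x => tendsto_inner_borelCalculus a hF (hF x) φ ψ
    fun _ _ => .of_forall fun r => (h r).tendsto x

theorem borelCalculus_add (hf : IsBoundedBorel f M) (hg : IsBoundedBorel g N) :
    borelCalculus a (fun r => f r + g r) = borelCalculus a f + borelCalculus a g := by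
  refine borelCalculus_eq_of_forall_inner a (hf.add hg) fun ψ => ?_
  rw [add_apply, inner_add_right, inner_borelCalculus_self a hf.measurable hf.norm_le,
    inner_borelCalculus_self a hg.measurable hg.norm_le]
  exact (integral_add (integrable_spectralMeasure a ψ hf.measurable hf.norm_le)
    (integrable_spectralMeasure a ψ hg.measurable hg.norm_le)).symm

theorem borelCalculus_const_mul (hg : IsBoundedBorel g M) (c : ℂ) :
    borelCalculus a (fun r => c * g r) = c • borelCalculus a g := by
  refine borelCalculus_eq_of_forall_inner a ((IsBoundedBorel.const c).mul hg) fun ψ => ?_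
  rw [smul_apply, inner_smul_right, inner_borelCalculus_self a hg.measurable hg.norm_le,
    integral_const_mul]

theorem adjoint_borelCalculus (hg : IsBoundedBorel g M) :
    (borelCalculus a g).adjoint = borelCalculus a fun r => conj (g r) := by
  refine (borelCalculus_eq_of_forall_inner a hg.star fun ψ => ?_).symm
  rw [ContinuousLinearMap.adjoint_inner_right, ← inner_conj_symm,
    inner_borelCalculus_self a hg.measurable hg.norm_le, ← integral_conj]

theorem inner_cfc_self_eq_integral (ψ : H) (f : C_c(ℝ, ℝ)) :
    inner ℂ ψ (cfc (fun r => f r) a ψ) = ((∫ r, f r ∂(spectralMeasure a ψ) : ℝ) : ℂ) := by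
  have hsa : IsSelfAdjoint (cfc (fun r => f r) a) := cfc_predicate _ _
  rw [integral_spectralMeasure]
  exact (hsa.isSymmetric.coe_re_inner_self_apply ψ).symm

theorem exists_spectrum_subset_Icc : ∃ R : ℝ, spectrum ℝ a ⊆ Set.Icc (-R) R := by
  obtain ⟨R, hR⟩ := (spectrum.isCompact (𝕜 := ℝ) a).isBounded.subset_closedBall 0
  exact ⟨R, by simpa [Real.closedBall_eq_Icc] using hR⟩

theorem exists_compactlySupported_seq {f : ℝ → ℝ} (hf : Continuous f) (hM : ∀ r, |f r| ≤ M) :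
    ∃ F : ℕ → C_c(ℝ, ℝ), (∀ j r, |F j r| ≤ M) ∧
      ∀ R : ℝ, ∀ᶠ j in atTop, Set.EqOn (F j) f (Set.Icc (-R) R) := by
  choose χ hχ_one hχ_supp hχ_mem using fun j : ℕ =>
    exists_continuousMap_one_of_isCompact_subset_isOpen
      (isCompact_Icc (a := -(j : ℝ)) (b := j)) isOpen_univ (Set.subset_univ _)
  refine ⟨fun j => ⟨⟨fun r => f r * χ j r, hf.mul (χ j).continuous⟩,
    HasCompactSupport.mul_left (hχ_supp j)⟩, fun j r => ?_, fun R => ?_⟩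
  · have h01 := (hχ_mem j).2 r
    change |f r * χ j r| ≤ M
    rw [abs_mul, abs_of_nonneg h01.1]
    exact (mul_le_of_le_one_right (abs_nonneg _) h01.2).trans (hM r)
  · filter_upwards [tendsto_natCast_atTop_atTop.eventually_ge_atTop R] with j hj r hr
    change f r * χ j r = f r
    rw [hχ_one j (Set.Icc_subset_Icc (neg_le_neg hj) hj hr), Pi.one_apply, mul_one]

theorem inner_cfc_self_eq_integral_of_continuous (ψ : H) {f : ℝ → ℝ} (hf : Continuous f)
    (hM : ∀ r, |f r| ≤ M) :
    inner ℂ ψ (cfc f a ψ) = ((∫ r, f r ∂(spectralMeasure a ψ) : ℝ) : ℂ) := by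
  obtain ⟨F, hFM, hF⟩ := exists_compactlySupported_seq hf hM
  obtain ⟨R, hR⟩ := exists_spectrum_subset_Icc a
  have hcfc : ∀ᶠ j in atTop, inner ℂ ψ (cfc f a ψ) = inner ℂ ψ (cfc (fun r => F j r) a ψ) := by
    filter_upwards [hF R] with j hj
    rw [cfc_congr fun r hr => hj (hR hr)]
  have hint : Tendsto (fun j => ∫ r, F j r ∂(spectralMeasure a ψ)) atTop
      (𝓝 (∫ r, f r ∂(spectralMeasure a ψ))) :=
    tendsto_integral_of_dominated_convergence (fun _ => M)
      (fun j => (F j).continuous.aestronglyMeasurable) (integrable_const _)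
      (fun j => .of_forall (hFM j)) <| .of_forall fun r =>
        tendsto_const_nhds.congr' ((hF |r|).mono fun j hj => (hj (abs_le.1 le_rfl)).symm)
  simp only [inner_cfc_self_eq_integral] at hcfc
  exact tendsto_nhds_unique (tendsto_const_nhds.congr' hcfc)
    ((Complex.continuous_ofReal.tendsto _).comp hint)

theorem borelCalculus_eq_cfc_add_cfc (hf : Continuous f) (hM : ∀ r, ‖f r‖ ≤ M) :
    borelCalculus a f = cfc (fun r => (f r).re) a + Complex.I • cfc (fun r => (f r).im) a := by
  refine borelCalculus_eq_of_forall_inner a ⟨hf.measurable, hM⟩ fun ψ => ?_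
  rw [add_apply, smul_apply, inner_add_right, inner_smul_right,
    inner_cfc_self_eq_integral_of_continuous a ψ (f := fun r => (f r).re) (by fun_prop)
      fun r => (Complex.abs_re_le_norm _).trans (hM r),
    inner_cfc_self_eq_integral_of_continuous a ψ (f := fun r => (f r).im) (by fun_prop)
      fun r => (Complex.abs_im_le_norm _).trans (hM r), mul_comm]
  exact integral_re_add_im (integrable_spectralMeasure a ψ hf.measurable hM)

variable {a} (ha : IsSelfAdjoint a)
include ha

theorem borelCalculus_eq_cfc (hf : Continuous f) (hM : ∀ r, ‖f r‖ ≤ M) :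
    borelCalculus a f = cfc (fun z : ℂ => f z.re) a := by
  rw [borelCalculus_eq_cfc_add_cfc a hf hM, cfc_real_eq_complex _ ha, cfc_real_eq_complex _ ha,
    ← cfc_smul Complex.I _ a (by fun_prop), ← cfc_add (a := a) _ _ (by fun_prop) (by fun_prop)]
  refine cfc_congr fun z _ => ?_
  simp only [smul_eq_mul, mul_comm Complex.I, Complex.re_add_im]

theorem borelCalculus_mul_of_continuous (hf : Continuous f) (hg : Continuous g)
    (hfM : ∀ r, ‖f r‖ ≤ M) (hgN : ∀ r, ‖g r‖ ≤ N) :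
    borelCalculus a (fun r => f r * g r) = borelCalculus a f * borelCalculus a g := by
  have hfg := ((⟨hf.measurable, hfM⟩ : IsBoundedBorel f M).mul
    (⟨hg.measurable, hgN⟩ : IsBoundedBorel g N)).norm_le
  rw [borelCalculus_eq_cfc ha hf hfM, borelCalculus_eq_cfc ha hg hgN,
    borelCalculus_eq_cfc ha (f := fun r => f r * g r) (hf.mul hg) hfg]
  exact cfc_mul (R := ℂ) _ _ a (by fun_prop) (by fun_prop)

omit ha in
theorem borelCalculus_mul_of_forall_continuous (hf : IsBoundedBorel f M) (hg : IsBoundedBorel g N)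
    (h : ∀ u : ℝ → ℂ, Continuous u → (∀ r, ‖u r‖ ≤ M) →
      borelCalculus a (fun r => u r * g r) = borelCalculus a u * borelCalculus a g) :
    borelCalculus a (fun r => f r * g r) = borelCalculus a f * borelCalculus a g := by
  classical
  ext ψ
  refine ext_inner_left ℂ fun φ => ?_
  let S := (polarization φ ψ).support ∪ (polarization φ (borelCalculus a g ψ)).support
  obtain ⟨u, huM, hu⟩ := exists_continuous_seq_tendsto_ae (∑ v ∈ S, spectralMeasure a v)
    hf.measurable.aestronglyMeasurable hf.nonneg hf.norm_le
  have hu' : ∀ v ∈ S, ∀ᵐ r ∂(spectralMeasure a v), Tendsto (fun n => u n r) atTop (𝓝 (f r)) :=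
    fun v hv => (Measure.absolutelyContinuous_of_le (Finset.single_le_sum
      (f := fun v => spectralMeasure a v) (fun _ _ => Measure.zero_le _) hv)).ae_le hu
  have huB : ∀ n, IsBoundedBorel (u n) M := fun n => ⟨(u n).continuous.measurable, huM n⟩
  have hlhs := tendsto_inner_borelCalculus a (fun n => (huB n).mul hg) (hf.mul hg) φ ψ
    fun v hv => (hu' v (Finset.mem_union_left _ hv)).mono fun r hr => hr.mul_const _
  have hrhs := tendsto_inner_borelCalculus a huB hf φ (borelCalculus a g ψ)
    fun v hv => hu' v (Finset.mem_union_right _ hv)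
  simp only [h _ (u _).continuous (huM _)] at hlhs
  exact tendsto_nhds_unique hlhs hrhs

theorem borelCalculus_mul (hf : IsBoundedBorel f M) (hg : IsBoundedBorel g N) :
    borelCalculus a (fun r => f r * g r) = borelCalculus a f * borelCalculus a g := by
  refine borelCalculus_mul_of_forall_continuous hf hg fun u hu huM => ?_
  have hu' : IsBoundedBorel u M := ⟨hu.measurable, huM⟩
  -- Taking adjoints exchanges the two factors, so the approximation applies to `g` as well.
  have hconj : borelCalculus a (fun r => conj (g r) * conj (u r))
      = borelCalculus a (fun r => conj (g r)) * borelCalculus a (fun r => conj (u r)) :=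
    borelCalculus_mul_of_forall_continuous hg.star hu'.star fun w hw hwN =>
      borelCalculus_mul_of_continuous ha hw (Complex.continuous_conj.comp hu) hwN hu'.star.norm_le
  have hadj := congrArg ContinuousLinearMap.adjoint hconj
  rw [ContinuousLinearMap.mul_def, ContinuousLinearMap.adjoint_comp,
    adjoint_borelCalculus a hg.star, adjoint_borelCalculus a hu'.star,
    adjoint_borelCalculus a (hg.star.mul hu'.star)] at hadj
  simpa only [map_mul, Complex.conj_conj, mul_comm (g _)] using! hadj

end BorelCalculus

section Resolvent

theorem ofReal_sub_ne_zero {z : ℂ} (hz : z.im ≠ 0) (r : ℝ) : (r : ℂ) - z ≠ 0 := fun h =>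
  hz (by simpa using congrArg Complex.im h)

theorem continuous_inv_ofReal_sub {z : ℂ} (hz : z.im ≠ 0) :
    Continuous fun r : ℝ => ((r : ℂ) - z)⁻¹ :=
  (Complex.continuous_ofReal.sub continuous_const).inv₀ (ofReal_sub_ne_zero hz)

theorem norm_inv_ofReal_sub_le {z : ℂ} (hz : z.im ≠ 0) (r : ℝ) :
    ‖((r : ℂ) - z)⁻¹‖ ≤ |z.im|⁻¹ := by
  rw [norm_inv]
  exact inv_anti₀ (abs_pos.2 hz) (by simpa using Complex.abs_im_le_norm ((r : ℂ) - z))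

theorem isBoundedBorel_inv_ofReal_sub {z : ℂ} (hz : z.im ≠ 0) :
    IsBoundedBorel (fun r : ℝ => ((r : ℂ) - z)⁻¹) |z.im|⁻¹ :=
  ⟨(continuous_inv_ofReal_sub hz).measurable, norm_inv_ofReal_sub_le hz⟩

variable {H : Type*} [NormedAddCommGroup H] [InnerProductSpace ℂ H] [CompleteSpace H]
  {a : H →L[ℂ] H} {z : ℂ}

theorem isUnit_sub_smul_id (ha : IsSelfAdjoint a) (hz : z.im ≠ 0) :
    IsUnit (a - z • ContinuousLinearMap.id ℂ H) := by
  have hspec : z ∉ spectrum ℂ a := fun h => hz (by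
    rw [ha.mem_spectrum_eq_re h, Complex.ofReal_im])
  rw [← IsUnit.neg_iff, neg_sub]
  exact spectrum.notMem_iff.1 hspec

theorem sub_smul_id_mul_borelCalculus (ha : IsSelfAdjoint a) (hz : z.im ≠ 0) :
    (a - z • ContinuousLinearMap.id ℂ H) * borelCalculus a (fun r => ((r : ℂ) - z)⁻¹) = 1 := by
  have hsub : a - z • ContinuousLinearMap.id ℂ H = cfc (fun w : ℂ => (w.re : ℂ) - z) a := by
    rw [cfc_congr fun w hw => congrArg (· - z) (ha.mem_spectrum_eq_re hw).symm,
      cfc_sub (R := ℂ) (fun w => w) (fun _ => z) a, cfc_id' ℂ a, cfc_const z a,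
      Algebra.algebraMap_eq_smul_one]
    rfl
  rw [hsub, borelCalculus_eq_cfc ha (continuous_inv_ofReal_sub hz) (norm_inv_ofReal_sub_le hz),
    ← cfc_mul _ (fun w : ℂ => ((w.re : ℂ) - z)⁻¹) a (by fun_prop)
      ((continuous_inv_ofReal_sub hz).comp Complex.continuous_re).continuousOn]
  simpa only [mul_inv_cancel₀ (ofReal_sub_ne_zero hz _)] using cfc_const_one ℂ a

theorem inverse_eq_borelCalculus (ha : IsSelfAdjoint a) (hz : z.im ≠ 0) :
    Ring.inverse (a - z • ContinuousLinearMap.id ℂ H)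
      = borelCalculus a (fun r => ((r : ℂ) - z)⁻¹) := by
  rw [← mul_one (Ring.inverse _), ← sub_smul_id_mul_borelCalculus ha hz,
    Ring.inverse_mul_cancel_left _ _ (isUnit_sub_smul_id ha hz)]

end Resolvent

section Variation

variable {H : Type*} [NormedAddCommGroup H] [InnerProductSpace ℂ H] [CompleteSpace H]
  {a : H →L[ℂ] H} {g : ℝ → ℂ} {M : ℝ} {I : Set ℝ}

theorem borelCalculus_spectralProjection_apply (ha : IsSelfAdjoint a) (hg : IsBoundedBorel g M)
    (hI : MeasurableSet I) (ψ : H) :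
    borelCalculus a g (spectralProjection a I ψ)
      = borelCalculus a (fun r => g r * I.indicator 1 r) ψ := by
  rw [borelCalculus_mul ha hg (.indicator_one hI)]
  rfl

theorem mixedSpectralMeasure_apply (φ ψ : H) {B : Set ℝ} (hB : MeasurableSet B) :
    mixedSpectralMeasure a φ ψ B = inner ℂ φ (borelCalculus a (B.indicator 1) ψ) :=
  if_pos hB

theorem isBoundedBorel_sum_mul_indicator {ι : Type*} (P : Finset ι) (c : ι → ℂ) {B : ι → Set ℝ}
    (hB : ∀ p ∈ P, MeasurableSet (B p)) :
    IsBoundedBorel (fun r => ∑ p ∈ P, c p * (B p).indicator 1 r) (∑ p ∈ P, ‖c p‖) := by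
  refine ⟨Finset.measurable_fun_sum P fun p hp => (measurable_one.indicator (hB p hp)).const_mul _,
    fun r => norm_sum_le_of_le P fun p hp => ?_⟩
  simpa using ((IsBoundedBorel.const (c p)).mul (.indicator_one (hB p hp))).norm_le r

theorem inner_borelCalculus_sum_mul_indicator {ι : Type*} (P : Finset ι) (c : ι → ℂ)
    {B : ι → Set ℝ} (hB : ∀ p ∈ P, MeasurableSet (B p)) (φ ψ : H) :
    inner ℂ φ (borelCalculus a (fun r => ∑ p ∈ P, c p * (B p).indicator 1 r) ψ)
      = ∑ p ∈ P, c p * mixedSpectralMeasure a φ ψ (B p) := by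
  classical
  induction P using Finset.induction_on with
  | empty =>
    have h0 : borelCalculus a (fun _ => 0) = 0 :=
      borelCalculus_eq_of_forall_inner a (IsBoundedBorel.const 0) (by simp)
    simp [h0]
  | insert p P hp ih =>
    have hBp := hB p (Finset.mem_insert_self p P)
    have hBP : ∀ q ∈ P, MeasurableSet (B q) := fun q hq => hB q (Finset.mem_insert_of_mem hq)
    simp only [Finset.sum_insert hp]
    rw [borelCalculus_add a ((IsBoundedBorel.const (c p)).mul (.indicator_one hBp))
      (isBoundedBorel_sum_mul_indicator P c hBP), borelCalculus_const_mul a (.indicator_one hBp),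
      add_apply, smul_apply, inner_add_right, inner_smul_right, ih hBP,
      mixedSpectralMeasure_apply φ ψ hBp]

theorem enorm_inner_borelCalculus_simpleFunc_le_variation (φ ψ : H) (hI : MeasurableSet I)
    (f : SimpleFunc ℝ ℂ) (hf : ∀ r, ‖f r‖ ≤ 1) :
    ‖inner ℂ φ (borelCalculus a (fun r => f r * I.indicator 1 r) ψ)‖ₑ
      ≤ (mixedSpectralMeasure a φ ψ).variation I := by
  classical
  have hB : ∀ c ∈ f.range, MeasurableSet (f ⁻¹' {c} ∩ I) := fun c _ =>
    (f.measurableSet_fiber c).inter hI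
  have hsum : (fun r => f r * I.indicator 1 r)
      = fun r => ∑ c ∈ f.range, c * (f ⁻¹' {c} ∩ I).indicator 1 r := by
    ext r
    rw [Finset.sum_eq_single_of_mem (f r) (f.mem_range_self r) fun c _ hc => by simp [hc.symm]]
    by_cases h : r ∈ I <;> simp [h]
  have hc : ∀ c ∈ f.range, ‖c‖ₑ ≤ 1 := fun c hc => by
    obtain ⟨r, rfl⟩ := SimpleFunc.mem_range.1 hc
    simpa [← ofReal_norm] using hf r
  have hdisj : (f.range : Set ℂ).PairwiseDisjoint fun c => f ⁻¹' {c} ∩ I := fun c _ c' _ hcc =>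
    Set.disjoint_left.2 fun _ hr hr' => hcc (hr.1.symm.trans hr'.1)
  rw [hsum, inner_borelCalculus_sum_mul_indicator f.range (fun c => c) hB]
  calc _ ≤ ∑ c ∈ f.range, ‖c * mixedSpectralMeasure a φ ψ (f ⁻¹' {c} ∩ I)‖ₑ := enorm_sum_le _ _
    _ ≤ ∑ c ∈ f.range, (mixedSpectralMeasure a φ ψ).variation (f ⁻¹' {c} ∩ I) := by
        refine Finset.sum_le_sum fun c hcr => ?_
        rw [enorm_mul]
        exact mul_le_of_le_one_of_le (hc c hcr) (VectorMeasure.enorm_measure_le_variation _ _)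
    _ = (mixedSpectralMeasure a φ ψ).variation (⋃ c ∈ f.range, f ⁻¹' {c} ∩ I) :=
        (measure_biUnion_finset hdisj hB).symm
    _ ≤ _ := measure_mono (Set.iUnion₂_subset fun c _ => Set.inter_subset_right)

theorem enorm_inner_borelCalculus_le_variation (φ ψ : H) (hI : MeasurableSet I)
    (hg : IsBoundedBorel g 1) :
    ‖inner ℂ φ (borelCalculus a (fun r => g r * I.indicator 1 r) ψ)‖ₑ
      ≤ (mixedSpectralMeasure a φ ψ).variation I := by
  have hsg := hg.measurable.stronglyMeasurable
  have hF : ∀ n r, ‖hsg.approxBounded 1 n r‖ ≤ 1 := hsg.norm_approxBounded_le zero_le_one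
  have hlim := tendsto_inner_borelCalculus a
    (fun n => (IsBoundedBorel.mk (hsg.approxBounded 1 n).measurable (hF n)).mul (.indicator_one hI))
    (hg.mul (.indicator_one hI)) φ ψ fun v _ => .of_forall fun r =>
      (hsg.tendsto_approxBounded_of_norm_le (hg.norm_le r)).mul_const _
  exact le_of_tendsto (hlim.enorm) (.of_forall fun n =>
    enorm_inner_borelCalculus_simpleFunc_le_variation φ ψ hI _ (hF n))

theorem norm_sum_mul_indicator_le_one {ι : Type*} (P : Finset ι) {c : ι → ℂ} {B : ι → Set ℝ}
    (hc : ∀ p ∈ P, ‖c p‖ ≤ 1) (hB : (P : Set ι).PairwiseDisjoint B) (r : ℝ) :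
    ‖∑ p ∈ P, c p * (B p).indicator 1 r‖ ≤ 1 :=
  calc ‖∑ p ∈ P, c p * (B p).indicator 1 r‖
      ≤ ∑ p ∈ P, (B p).indicator (1 : ℝ → ℝ) r := norm_sum_le_of_le P fun p hp => by
        by_cases hr : r ∈ B p <;> simp [hr, hc p hp]
    _ = (⋃ p ∈ P, B p).indicator 1 r := (Finset.indicator_biUnion_apply P B hB r).symm
    _ ≤ 1 := Set.indicator_le_self' (fun _ _ => zero_le_one) r

theorem variation_le_iSup_enorm_inner_borelCalculus (φ ψ : H) (hI : MeasurableSet I) :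
    (mixedSpectralMeasure a φ ψ).variation I
      ≤ ⨆ g : {g : ℝ → ℂ // Measurable g ∧ ∀ r, ‖g r‖ ≤ 1},
        ‖inner ℂ φ (borelCalculus a (fun r => (g : ℝ → ℂ) r * I.indicator 1 r) ψ)‖ₑ := by
  refine le_of_forall_lt fun t ht => ?_
  obtain ⟨P, hPI, hP_disj, hP_meas, hP⟩ := VectorMeasure.exists_lt_sum_of_lt_variation _ hI ht
  -- On each piece of the partition, `g` is the phase that makes its contribution nonnegative.
  choose c hc_norm hc using fun p => RCLike.exists_norm_eq_mul_self (mixedSpectralMeasure a φ ψ p)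
  have hg : Measurable fun r => ∑ p ∈ P, c p * p.indicator 1 r :=
    (isBoundedBorel_sum_mul_indicator P c (B := fun p => p) hP_meas).measurable
  have hg_le :=
    norm_sum_mul_indicator_le_one P (B := fun p => p) (fun p _ => (hc_norm p).le) hP_disj
  refine hP.trans_le (le_iSup_of_le ⟨_, hg, hg_le⟩ (le_of_eq ?_))
  have hgI : (fun r => (∑ p ∈ P, c p * p.indicator 1 r) * I.indicator 1 r)
      = fun r => ∑ p ∈ P, c p * p.indicator 1 r := by
    ext r
    rw [Finset.sum_mul]
    refine Finset.sum_congr rfl fun p hp => ?_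
    by_cases hr : r ∈ p
    · simp [hPI p hp hr]
    · simp [hr]
  have hsum : inner ℂ φ (borelCalculus a (fun r => ∑ p ∈ P, c p * p.indicator 1 r) ψ)
      = ((∑ p ∈ P, ‖mixedSpectralMeasure a φ ψ p‖ : ℝ) : ℂ) := by
    rw [inner_borelCalculus_sum_mul_indicator P c hP_meas]
    simp only [← hc, Complex.ofReal_sum, Complex.coe_algebraMap]
  rw [hgI, hsum, ← ofReal_norm, Complex.norm_real,
    Real.norm_of_nonneg (Finset.sum_nonneg fun _ _ => norm_nonneg _),
    ENNReal.ofReal_sum_of_nonneg fun _ _ => norm_nonneg _]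
  simp only [ofReal_norm]

theorem variation_mixedSpectralMeasure (ha : IsSelfAdjoint a) (φ ψ : H) (hI : MeasurableSet I) :
    (mixedSpectralMeasure a φ ψ).variation I
      = ⨆ g : {g : ℝ → ℂ // Measurable g ∧ ∀ r, ‖g r‖ ≤ 1},
        ‖inner ℂ φ (borelCalculus a g (spectralProjection a I ψ))‖ₑ := by
  have hproj := fun g : {g : ℝ → ℂ // Measurable g ∧ ∀ r, ‖g r‖ ≤ 1} =>
    borelCalculus_spectralProjection_apply ha ⟨g.2.1, g.2.2⟩ hI ψ
  simp only [hproj]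
  exact le_antisymm (variation_le_iSup_enorm_inner_borelCalculus φ ψ hI) (iSup_le fun g =>
    enorm_inner_borelCalculus_le_variation φ ψ hI ⟨g.2.1, g.2.2⟩)

end Variation

section StoneFormula

variable {H : Type*} [NormedAddCommGroup H] [InnerProductSpace ℂ H] [CompleteSpace H]
  {a : H →L[ℂ] H} {f : ℝ → ℂ} {γ : ℝ≥0}

section Fubini

variable {X : Type*} [MeasurableSpace X] {μ : Measure X} [SFinite μ] {k : X → ℝ → ℂ} {b : X → ℝ}

theorem isBoundedBorel_integral (hk : Measurable k.uncurry) (hb : Integrable b μ)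
    (hkb : ∀ p r, ‖k p r‖ ≤ b p) : IsBoundedBorel (fun r => ∫ p, k p r ∂μ) (∫ p, b p ∂μ) where
  measurable := hk.stronglyMeasurable.integral_prod_left.measurable
  norm_le r := norm_integral_le_of_norm_le hb (.of_forall fun p => hkb p r)

variable (a) in
theorem inner_borelCalculus_integral (hk : Measurable k.uncurry) (hb : Integrable b μ)
    (hkb : ∀ p r, ‖k p r‖ ≤ b p) (φ ψ : H) :
    inner ℂ φ (borelCalculus a (fun r => ∫ p, k p r ∂μ) ψ)
      = ∫ p, inner ℂ φ (borelCalculus a (k p) ψ) ∂μ := by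
  have hkp : ∀ p, IsBoundedBorel (k p) (b p) := fun p =>
    ⟨hk.comp measurable_prodMk_left, hkb p⟩
  have hint : ∀ v, Integrable k.uncurry (μ.prod (spectralMeasure a v)) := fun v =>
    (hb.comp_fst _).mono' hk.aestronglyMeasurable (.of_forall fun p => hkb p.1 p.2)
  have hinner : ∀ v, Integrable (fun p => ∫ r, k p r ∂(spectralMeasure a v)) μ := fun v =>
    (hint v).integral_prod_left
  simp only [inner_borelCalculus a (isBoundedBorel_integral hk hb hkb),
    inner_borelCalculus a (hkp _), Finsupp.linearCombination_apply, Finsupp.sum,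
    smul_eq_mul]
  rw [integral_finsetSum _ fun v _ => (hinner v).const_mul _]
  exact Finset.sum_congr rfl fun v _ => by
    rw [integral_const_mul, integral_integral_swap (hint v)]

end Fubini

theorem cauchyPDFReal_comm (x y : ℝ) (γ : ℝ≥0) : cauchyPDFReal x γ y = cauchyPDFReal y γ x := by
  rw [cauchyPDFReal_def, cauchyPDFReal_def, ← neg_sub, neg_sq]

theorem cauchyPDFReal_nonneg (x : ℝ) (γ : ℝ≥0) (y : ℝ) : 0 ≤ cauchyPDFReal x γ y := by
  rw [cauchyPDFReal_def]
  positivity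

theorem cauchyPDFReal_le (x : ℝ) (γ : ℝ≥0) (y : ℝ) :
    cauchyPDFReal x γ y ≤ (Real.pi)⁻¹ * (γ : ℝ)⁻¹ := by
  rw [cauchyPDFReal_def']
  exact mul_le_of_le_one_right (by positivity)
    (inv_le_one_of_one_le₀ (le_add_of_nonneg_right (sq_nonneg _)))

theorem integral_cauchyPDFReal_le_one (x : ℝ) (γ : ℝ≥0) : ∫ y, cauchyPDFReal x γ y ≤ 1 := by
  rcases eq_or_ne γ 0 with rfl | hγ
  · simp
  · exact (integral_cauchyPDFReal_eq_one x hγ).le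

theorem ofReal_cauchyPDFReal (E : ℝ) (γ : ℝ≥0) (r : ℝ) :
    (cauchyPDFReal E γ r : ℂ) = (Real.pi : ℂ)⁻¹ * γ
      * (conj ((r : ℂ) - (E + γ * Complex.I))⁻¹ * ((r : ℂ) - (E + γ * Complex.I))⁻¹) := by
  rw [← Complex.normSq_eq_conj_mul_self, Complex.normSq_inv, Complex.normSq_apply,
    cauchyPDFReal_def]
  simp [sq]

/-- The Poisson integral of `f`: the value at `r + iγ` of the bounded harmonic function on the upper
half-plane with boundary values `f`. -/
def poissonIntegral (f : ℝ → ℂ) (γ : ℝ≥0) (r : ℝ) : ℂ := ∫ E, (cauchyPDFReal E γ r : ℂ) * f E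

theorem norm_poissonIntegral_le_one (hf : ∀ r, ‖f r‖ ≤ 1) (γ : ℝ≥0) (r : ℝ) :
    ‖poissonIntegral f γ r‖ ≤ 1 := by
  simp only [poissonIntegral, cauchyPDFReal_comm _ r]
  refine (norm_integral_le_of_norm_le (integrable_cauchyPDFReal r)
    (.of_forall fun E => ?_)).trans (integral_cauchyPDFReal_le_one r γ)
  rw [norm_mul, Complex.norm_real, Real.norm_of_nonneg (cauchyPDFReal_nonneg r γ E)]
  exact mul_le_of_le_one_right (cauchyPDFReal_nonneg r γ E) (hf E)

theorem tendsto_norm_mul_cauchyPDFReal_cobounded :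
    Tendsto (fun r : ℝ => ‖r‖ * cauchyPDFReal 0 1 r) (Bornology.cobounded ℝ) (𝓝 0) := by
  refine squeeze_zero' (.of_forall fun r => mul_nonneg (norm_nonneg r) (cauchyPDFReal_nonneg 0 1 r))
    ?_ tendsto_norm_cobounded_atTop.inv_tendsto_atTop
  filter_upwards [Bornology.eventually_ne_cobounded 0] with r hr
  have hpi : (Real.pi)⁻¹ ≤ 1 := inv_le_one_of_one_le₀ (by linarith [Real.pi_gt_three])
  calc ‖r‖ * cauchyPDFReal 0 1 r = (Real.pi)⁻¹ * (‖r‖ * (r ^ 2 + 1)⁻¹) := by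
        rw [cauchyPDFReal_def, NNReal.coe_one, sub_zero]
        ring
    _ ≤ 1 * (‖r‖ * (r ^ 2)⁻¹) := by
        gcongr
        linarith
    _ = ‖r‖⁻¹ := by
        rw [← Real.norm_of_nonneg (sq_nonneg r), norm_pow]
        field_simp

theorem tendsto_poissonIntegral (hf : Integrable f) {r : ℝ} (hfr : ContinuousAt f r) :
    Tendsto (fun γ => poissonIntegral f γ r) (𝓝[≠] 0) (𝓝 (f r)) := by
  have hlim := tendsto_integral_comp_smul_smul_of_integrable' (μ := volume)
    (cauchyPDFReal_nonneg 0 1) (integral_cauchyPDFReal_eq_one 0 one_ne_zero)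
    (by simpa using tendsto_norm_mul_cauchyPDFReal_cobounded) hf hfr
  have hγ : Tendsto (fun γ : ℝ≥0 => (γ : ℝ)⁻¹) (𝓝[≠] 0) atTop := by
    refine tendsto_inv_nhdsGT_zero.comp (tendsto_nhdsWithin_iff.2
      ⟨(NNReal.continuous_coe.tendsto' 0 0 rfl).mono_left nhdsWithin_le_nhds, ?_⟩)
    filter_upwards [self_mem_nhdsWithin] with γ hγ using NNReal.coe_pos.2 (pos_iff_ne_zero.2 hγ)
  refine (hlim.comp hγ).congr fun γ => integral_congr_ae (.of_forall fun E => ?_)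
  have hk : (γ : ℝ)⁻¹ * cauchyPDFReal 0 1 ((γ : ℝ)⁻¹ * (r - E)) = cauchyPDFReal E γ r := by
    simp only [cauchyPDFReal_def', NNReal.coe_one, div_eq_inv_mul, inv_one,
      NNReal.coe_inv]
    ring
  simp only [Module.finrank_self, pow_one, smul_eq_mul, hk, Complex.real_smul]

theorem inner_borelCalculus_cauchyPDFReal (ha : IsSelfAdjoint a) (hγ : γ ≠ 0) (E : ℝ) (φ ψ : H) :
    inner ℂ φ (borelCalculus a (fun r => (cauchyPDFReal E γ r : ℂ)) ψ)
      = (Real.pi : ℂ)⁻¹ * γ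
        * inner ℂ (Ring.inverse (a - (E + γ * Complex.I : ℂ) • ContinuousLinearMap.id ℂ H) φ)
          (Ring.inverse (a - (E + γ * Complex.I : ℂ) • ContinuousLinearMap.id ℂ H) ψ) := by
  have hz : (E + γ * Complex.I : ℂ).im ≠ 0 := by simpa using hγ
  have hR := isBoundedBorel_inv_ofReal_sub hz
  simp only [ofReal_cauchyPDFReal]
  rw [borelCalculus_const_mul a (hR.star.mul hR), borelCalculus_mul ha hR.star hR,
    ← adjoint_borelCalculus a hR, ← inverse_eq_borelCalculus ha hz, smul_apply, inner_smul_right,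
    mul_apply_eq_comp, ContinuousLinearMap.adjoint_inner_right]

theorem inner_borelCalculus_poissonIntegral (ha : IsSelfAdjoint a) (hfc : Continuous f)
    (hf : Integrable f) (hγ : γ ≠ 0) (φ ψ : H) :
    inner ℂ φ (borelCalculus a (poissonIntegral f γ) ψ) = ∫ E, (Real.pi : ℂ)⁻¹ * f E
        * (γ * inner ℂ (Ring.inverse (a - (E + γ * Complex.I : ℂ) • ContinuousLinearMap.id ℂ H) φ)
          (Ring.inverse (a - (E + γ * Complex.I : ℂ) • ContinuousLinearMap.id ℂ H) ψ)) := by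
  have hk : Measurable (Function.uncurry fun E r : ℝ => f E * (cauchyPDFReal E γ r : ℂ)) := by
    simp only [cauchyPDFReal_def, Function.uncurry_def]
    fun_prop
  have hkb : ∀ E r, ‖f E * (cauchyPDFReal E γ r : ℂ)‖ ≤ ‖f E‖ * ((Real.pi)⁻¹ * (γ : ℝ)⁻¹) :=
    fun E r => by
      rw [norm_mul, Complex.norm_real, Real.norm_of_nonneg (cauchyPDFReal_nonneg E γ r)]
      gcongr
      exact cauchyPDFReal_le E γ r
  have hcauchy : ∀ E, IsBoundedBorel (fun r => (cauchyPDFReal E γ r : ℂ))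
      ((Real.pi)⁻¹ * (γ : ℝ)⁻¹) := fun E =>
    ⟨Complex.measurable_ofReal.comp (measurable_cauchyPDFReal E γ), fun r => by
      rw [Complex.norm_real, Real.norm_of_nonneg (cauchyPDFReal_nonneg E γ r)]
      exact cauchyPDFReal_le E γ r⟩
  have hP : poissonIntegral f γ = fun r => ∫ E, f E * (cauchyPDFReal E γ r : ℂ) := by
    ext r
    simp only [poissonIntegral, mul_comm]
  rw [hP, inner_borelCalculus_integral a hk (hf.norm.mul_const _) hkb]
  refine integral_congr_ae (.of_forall fun E => ?_)
  simp only [borelCalculus_const_mul a (hcauchy E), smul_apply, inner_smul_right,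
    inner_borelCalculus_cauchyPDFReal ha hγ]
  ring

theorem isBoundedBorel_poissonIntegral (hfc : Continuous f) (hf : ∀ r, ‖f r‖ ≤ 1) (γ : ℝ≥0) :
    IsBoundedBorel (poissonIntegral f γ) 1 := by
  refine ⟨StronglyMeasurable.measurable ?_, norm_poissonIntegral_le_one hf γ⟩
  refine StronglyMeasurable.integral_prod_right (f := fun r E => (cauchyPDFReal E γ r : ℂ) * f E) ?_
  refine Measurable.stronglyMeasurable ?_
  simp only [cauchyPDFReal_def, Function.uncurry_def]
  fun_prop

theorem enorm_inner_borelCalculus_le_liminf (ha : IsSelfAdjoint a) {I : Set ℝ}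
    (hI_vol : volume I ≠ ⊤) (hfc : Continuous f) (hf : ∀ r, ‖f r‖ ≤ 1)
    (hfI : ∀ r ∉ I, f r = 0) (φ ψ : H) :
    ‖inner ℂ φ (borelCalculus a f ψ)‖ₑ ≤ liminf (fun γ : ℝ≥0 => ∫⁻ E in I,
      ‖γ * inner ℂ (Ring.inverse (a - (E + γ * Complex.I : ℂ) • ContinuousLinearMap.id ℂ H) φ)
        (Ring.inverse (a - (E + γ * Complex.I : ℂ) • ContinuousLinearMap.id ℂ H) ψ)‖ₑ)
      (𝓝[≠] 0) := by
  have hf_int : Integrable f := by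
    refine (integrableOn_iff_integrable_of_support_subset
      (Function.support_subset_iff'.2 hfI)).1 ?_
    exact Measure.integrableOn_of_bounded hI_vol hfc.aestronglyMeasurable (.of_forall hf)
  have hlim := tendsto_inner_borelCalculus a (isBoundedBorel_poissonIntegral hfc hf)
    ⟨hfc.measurable, hf⟩ φ ψ fun v _ => .of_forall fun r =>
      tendsto_poissonIntegral hf_int hfc.continuousAt
  rw [← hlim.enorm.liminf_eq]
  refine liminf_le_liminf ?_
  filter_upwards [self_mem_nhdsWithin] with γ hγ
  rw [inner_borelCalculus_poissonIntegral ha hfc hf_int hγ,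
    ← setIntegral_eq_integral_of_forall_compl_eq_zero (s := I) fun E hE => by simp [hfI E hE]]
  refine (enorm_integral_le_lintegral_enorm _).trans (lintegral_mono fun E => ?_)
  refine (enorm_mul _ _).trans_le (mul_le_of_le_one_left' ?_)
  rw [← ofReal_norm, ENNReal.ofReal_le_one, norm_mul, norm_inv, Complex.norm_real,
    Real.norm_of_nonneg Real.pi_pos.le]
  exact mul_le_one₀ (inv_le_one_of_one_le₀ (by linarith [Real.pi_gt_three])) (norm_nonneg _) (hf E)

end StoneFormula

section WeakMeasurability

variable {Ω : Type*} [MeasurableSpace Ω] {H : Type*} [NormedAddCommGroup H]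
  [InnerProductSpace ℂ H]

/-- Weak measurability of a random operator: all its matrix elements are measurable. -/
def WeaklyMeasurable (a : Ω → H →L[ℂ] H) : Prop :=
  ∀ φ ψ, Measurable fun o => inner ℂ φ (a o ψ)

namespace WeaklyMeasurable

variable {a b : Ω → H →L[ℂ] H}

theorem const (T : H →L[ℂ] H) : WeaklyMeasurable fun _ : Ω => T := fun _ _ => measurable_const

theorem add (ha : WeaklyMeasurable a) (hb : WeaklyMeasurable b) :
    WeaklyMeasurable fun o => a o + b o := fun φ ψ => by
  simpa only [add_apply, inner_add_right] using (ha φ ψ).fun_add (hb φ ψ)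

theorem const_smul (ha : WeaklyMeasurable a) (c : ℂ) : WeaklyMeasurable fun o => c • a o :=
  fun φ ψ => by simpa only [smul_apply, inner_smul_right] using (ha φ ψ).const_mul c

theorem of_tendsto {F : ℕ → Ω → H →L[ℂ] H} (hF : ∀ j, WeaklyMeasurable (F j))
    (h : ∀ o, Tendsto (fun j => F j o) atTop (𝓝 (a o))) : WeaklyMeasurable a := fun φ ψ =>
  measurable_of_tendsto_metrizable (fun j => hF j φ ψ) <| tendsto_pi_nhds.2 fun o =>
    ((continuous_const.inner (ContinuousLinearMap.apply ℂ H ψ).continuous).tendsto (a o)).comp (h o)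

section HilbertBasis

variable {ι : Type*} [Countable ι]

theorem mul [CompleteSpace H] (e : HilbertBasis ι ℂ H) (ha : WeaklyMeasurable a)
    (hb : WeaklyMeasurable b) : WeaklyMeasurable fun o => a o * b o := fun φ ψ => by
  refine measurable_of_tendsto_metrizable' atTop
    (f := fun s o => ∑ i ∈ s, inner ℂ φ (a o (e i)) * inner ℂ (e i) (b o ψ))
    (fun s => Finset.measurable_fun_sum s fun i _ => (ha φ (e i)).mul (hb (e i) ψ))
    (tendsto_pi_nhds.2 fun o => ?_)
  simpa only [HasSum, ContinuousLinearMap.adjoint_inner_left, mul_apply_eq_comp,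
    SummationFilter.unconditional_filter]
    using e.hasSum_inner_mul_inner ((a o).adjoint φ) (b o ψ)

theorem pow [CompleteSpace H] (e : HilbertBasis ι ℂ H) (ha : WeaklyMeasurable a) (k : ℕ) :
    WeaklyMeasurable fun o => a o ^ k := by
  induction k with
  | zero => simpa only [pow_zero] using const 1
  | succ k ih => simpa only [pow_succ] using ih.mul e ha

theorem aeval [CompleteSpace H] (e : HilbertBasis ι ℂ H) (ha : WeaklyMeasurable a)
    (p : Polynomial ℝ) : WeaklyMeasurable fun o => Polynomial.aeval (a o) p := by
  induction p using Polynomial.induction_on' with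
  | add p q hp hq => simpa only [map_add] using hp.add hq
  | monomial k c =>
    convert (ha.pow e k).const_smul (c : ℂ) using 2 with o
    rw [Polynomial.aeval_monomial, ← Algebra.smul_def, Complex.coe_smul]

end HilbertBasis
end WeaklyMeasurable

variable [CompleteSpace H]

theorem exists_polynomial_seq_tendsto_cfc {f : ℝ → ℝ} (hf : Continuous f) :
    ∃ p : ℕ → Polynomial ℝ, ∀ a : H →L[ℂ] H, IsSelfAdjoint a →
      Tendsto (fun j => Polynomial.aeval a (p j)) atTop (𝓝 (cfc f a)) := by
  choose p hp using fun j : ℕ => exists_polynomial_near_of_continuousOn (-(j : ℝ)) j f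
    hf.continuousOn (1 / ((j : ℝ) + 1)) Nat.one_div_pos_of_nat
  refine ⟨p, fun a ha => tendsto_iff_norm_sub_tendsto_zero.2 ?_⟩
  obtain ⟨R, hR⟩ := exists_spectrum_subset_Icc a
  refine squeeze_zero' (.of_forall fun _ => norm_nonneg _) ?_
    tendsto_one_div_add_atTop_nhds_zero_nat
  filter_upwards [eventually_ge_atTop ⌈R⌉₊] with j hj
  have hRj : R ≤ j := Nat.ceil_le.1 hj
  rw [← cfc_polynomial (R := ℝ) (p j) a ha,
    ← cfc_sub (R := ℝ) _ f _ (p j).continuous.continuousOn hf.continuousOn]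
  exact norm_cfc_le Nat.one_div_pos_of_nat.le fun r hr =>
    (hp j r (Set.Icc_subset_Icc (neg_le_neg hRj) hRj (hR hr))).le

namespace WeaklyMeasurable

variable {ι : Type*} [Countable ι] {a : Ω → H →L[ℂ] H}

theorem cfc (e : HilbertBasis ι ℂ H) (ha : WeaklyMeasurable a) (hsa : ∀ o, IsSelfAdjoint (a o))
    {f : ℝ → ℝ} (hf : Continuous f) : WeaklyMeasurable fun o => cfc f (a o) := by
  obtain ⟨p, hp⟩ := exists_polynomial_seq_tendsto_cfc (H := H) hf
  exact of_tendsto (fun j => ha.aeval e (p j)) fun o => hp _ (hsa o)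

theorem measurable_spectralMeasure (e : HilbertBasis ι ℂ H) (ha : WeaklyMeasurable a)
    (hsa : ∀ o, IsSelfAdjoint (a o)) (ψ : H) : Measurable fun o => spectralMeasure (a o) ψ := by
  have hmeas : ∀ F : Set ℝ, IsClosed F → Measurable fun o => spectralMeasure (a o) ψ F := by
    intro F hF
    refine measurable_of_tendsto_metrizable (f := fun n o =>
      ∫⁻ r, hF.apprSeq n r ∂(spectralMeasure (a o) ψ)) (fun n => ?_)
      (tendsto_pi_nhds.2 fun o => HasOuterApproxClosed.tendsto_lintegral_apprSeq hF _)
    have hcont : Continuous fun r => (hF.apprSeq n r : ℝ) := by fun_prop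
    have hle : ∀ r, |(hF.apprSeq n r : ℝ)| ≤ 1 := fun r => by
      rw [NNReal.abs_eq]
      exact_mod_cast HasOuterApproxClosed.apprSeq_apply_le_one hF n r
    have heq : ∀ o, ∫⁻ r, hF.apprSeq n r ∂(spectralMeasure (a o) ψ)
        = ENNReal.ofReal (inner ℂ ψ (_root_.cfc (fun r => (hF.apprSeq n r : ℝ)) (a o) ψ)).re := by
      intro o
      rw [inner_cfc_self_eq_integral_of_continuous (a o) ψ hcont hle, Complex.ofReal_re,
        ← BoundedContinuousFunction.toReal_lintegral_coe_eq_integral,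
        ENNReal.ofReal_toReal (BoundedContinuousFunction.lintegral_lt_top_of_nnreal _ _).ne]
    simp only [heq]
    exact (Complex.measurable_re.comp (ha.cfc e hsa hcont ψ ψ)).ennreal_ofReal
  exact .measure_of_isPiSystem borel_eq_generateFrom_isClosed isPiSystem_isClosed hmeas
    (hmeas _ isClosed_univ)

theorem borelCalculus (e : HilbertBasis ι ℂ H) (ha : WeaklyMeasurable a)
    (hsa : ∀ o, IsSelfAdjoint (a o)) {g : ℝ → ℂ} {M : ℝ} (hg : IsBoundedBorel g M) :
    WeaklyMeasurable fun o => borelCalculus (a o) g := fun φ ψ => by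
  simp only [inner_borelCalculus _ hg, Finsupp.linearCombination_apply, Finsupp.sum]
  refine Finset.measurable_fun_sum _ fun v _ => Measurable.fun_const_smul ?_ _
  let κ : Kernel Ω ℝ := ⟨_, ha.measurable_spectralMeasure e hsa v⟩
  exact (hg.measurable.stronglyMeasurable.integral_kernel (κ := κ)).measurable

end WeaklyMeasurable
end WeakMeasurability

section Suprema

theorem measurable_iSup_of_continuous {Ω X : Type*} [MeasurableSpace Ω] [TopologicalSpace X]
    [TopologicalSpace.SeparableSpace X] {F : X → Ω → ℝ≥0∞} (hF : ∀ x, Measurable (F x))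
    (hc : ∀ o, Continuous fun x => F x o) : Measurable fun o => ⨆ x, F x o := by
  obtain ⟨D, hD, hDd⟩ := TopologicalSpace.exists_countable_dense X
  have := hD.to_subtype
  simp only [← fun o => hDd.ciSup' (hc o)]
  exact .iSup fun x => hF x

theorem exists_continuous_seq_tendsto_indicator {X : Type*} [TopologicalSpace X]
    [HasOuterApproxClosed X] {U : Set X} (hU : IsOpen U) :
    ∃ χ : ℕ → C(X, ℂ), (∀ j r, ‖χ j r‖ ≤ 1) ∧ (∀ j, ∀ r ∉ U, χ j r = 0) ∧
      ∀ r, Tendsto (fun j => χ j r) atTop (𝓝 (U.indicator 1 r)) := by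
  have hF := hU.isClosed_compl
  refine ⟨fun j => ⟨fun r => ((1 - hF.apprSeq j r : ℝ≥0) : ℂ), by fun_prop⟩, fun j r => ?_,
    fun j r hr => ?_, fun r => ?_⟩
  · simp
  · simp [HasOuterApproxClosed.apprSeq_apply_eq_one hF j hr]
  · have hlim : ((1 - Uᶜ.indicator (fun _ => 1) r : ℝ≥0) : ℂ) = U.indicator 1 r := by
      by_cases hr : r ∈ U <;> simp [hr]
    rw [← hlim]
    have hcont : Continuous fun t : ℝ≥0 => ((1 - t : ℝ≥0) : ℂ) := by fun_prop
    exact (hcont.tendsto _).comp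
      (tendsto_pi_nhds.1 (HasOuterApproxClosed.tendsto_apprSeq hF) r)

variable {H : Type*} [NormedAddCommGroup H] [InnerProductSpace ℂ H] [CompleteSpace H]
  {a : H →L[ℂ] H} {I : Set ℝ}

theorem variation_mixedSpectralMeasure_eq_iSup_continuous (ha : IsSelfAdjoint a) (φ ψ : H)
    (hI : MeasurableSet I) :
    (mixedSpectralMeasure a φ ψ).variation I = ⨆ q : {q : C(ℝ, ℂ) | ∀ r, ‖q r‖ ≤ 1},
      ‖inner ℂ φ (borelCalculus a (fun r => q.1 r * I.indicator 1 r) ψ)‖ₑ := by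
  rw [variation_mixedSpectralMeasure ha φ ψ hI]
  refine le_antisymm (iSup_le fun ⟨g, hg, hg_le⟩ => ?_) (iSup_le fun ⟨q, hq⟩ => ?_)
  · obtain ⟨F, hF_le, hF⟩ := exists_continuous_seq_tendsto_ae
      (∑ v ∈ (polarization φ ψ).support, spectralMeasure a v) hg.aestronglyMeasurable
      zero_le_one hg_le
    have hχ : IsBoundedBorel (I.indicator 1) 1 := .indicator_one hI
    have hFb : ∀ n, IsBoundedBorel (F n) 1 := fun n => ⟨(F n).continuous.measurable, hF_le n⟩
    rw [borelCalculus_spectralProjection_apply ha ⟨hg, hg_le⟩ hI]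
    refine le_of_tendsto (tendsto_inner_borelCalculus (l := atTop) a (fun n => (hFb n).mul hχ)
      (IsBoundedBorel.mul ⟨hg, hg_le⟩ hχ) φ ψ fun v hv => ?_).enorm
      (.of_forall fun n => le_iSup_of_le ⟨F n, hF_le n⟩ le_rfl)
    rw [ae_finsetSum_measure_iff] at hF
    filter_upwards [hF v hv] with r hr using hr.mul_const _
  · refine le_iSup_of_le ⟨q, q.continuous.measurable, hq⟩ ?_
    rw [borelCalculus_spectralProjection_apply ha ⟨q.continuous.measurable, hq⟩ hI]

theorem continuous_inner_borelCalculus_mul_indicator (hI : MeasurableSet I) (φ ψ : H) :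
    Continuous fun q : {q : C(ℝ, ℂ) | ∀ r, ‖q r‖ ≤ 1} =>
      inner ℂ φ (borelCalculus a (fun r => q.1 r * I.indicator 1 r) ψ) :=
  continuous_inner_borelCalculus a
    (fun q => IsBoundedBorel.mul ⟨q.1.continuous.measurable, q.2⟩ (.indicator_one hI))
    (fun r => ((continuous_eval_const r).comp continuous_subtype_val).mul_const _) φ ψ

theorem WeaklyMeasurable.measurable_variation {Ω ι : Type*} [MeasurableSpace Ω] [Countable ι]
    {a : Ω → H →L[ℂ] H} (e : HilbertBasis ι ℂ H) (ha : WeaklyMeasurable a)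
    (hsa : ∀ o, IsSelfAdjoint (a o)) (hI : MeasurableSet I) (φ ψ : H) :
    Measurable fun o => (mixedSpectralMeasure (a o) φ ψ).variation I := by
  simp only [fun o => variation_mixedSpectralMeasure_eq_iSup_continuous (hsa o) φ ψ hI]
  exact measurable_iSup_of_continuous
    (fun q => (ha.borelCalculus e hsa (IsBoundedBorel.mul ⟨q.1.continuous.measurable, q.2⟩
      (.indicator_one hI)) φ ψ).enorm)
    fun o => (continuous_inner_borelCalculus_mul_indicator hI φ ψ).enorm

theorem variation_mixedSpectralMeasure_le_liminf (ha : IsSelfAdjoint a) (hI : IsOpen I)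
    (hI_vol : volume I ≠ ⊤) (φ ψ : H) :
    (mixedSpectralMeasure a φ ψ).variation I ≤ liminf (fun γ : ℝ≥0 => ∫⁻ E in I,
      ‖(γ : ℂ) * inner ℂ (Ring.inverse (a - (E + γ * Complex.I : ℂ) • ContinuousLinearMap.id ℂ H) φ)
        (Ring.inverse (a - (E + γ * Complex.I : ℂ) • ContinuousLinearMap.id ℂ H) ψ)‖ₑ)
      (𝓝[≠] 0) := by
  rw [variation_mixedSpectralMeasure_eq_iSup_continuous ha φ ψ hI.measurableSet]
  refine iSup_le fun ⟨q, hq⟩ => ?_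
  obtain ⟨χ, hχ_le, hχ_zero, hχ⟩ := exists_continuous_seq_tendsto_indicator hI
  have hqb : IsBoundedBorel q 1 := ⟨q.continuous.measurable, hq⟩
  have hχb : ∀ j, IsBoundedBorel (χ j) 1 := fun j => ⟨(χ j).continuous.measurable, hχ_le j⟩
  refine le_of_tendsto (tendsto_inner_borelCalculus a (fun j => hqb.mul (hχb j))
    (hqb.mul (.indicator_one hI.measurableSet)) φ ψ
    fun v _ => .of_forall fun r => (hχ r).const_mul _).enorm (.of_forall fun j => ?_)
  exact enorm_inner_borelCalculus_le_liminf ha hI_vol (q.continuous.mul (χ j).continuous)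
    (by simpa using (hqb.mul (hχb j)).norm_le) (fun r hr => by simp [hχ_zero j r hr]) φ ψ

end Suprema

section RankOne

variable {H : Type*} [NormedAddCommGroup H] [InnerProductSpace ℂ H] [CompleteSpace H]
  {T T' : H →L[ℂ] H} {z : ℂ}

theorem sub_smul_inverse_apply (hT : IsSelfAdjoint T) (hz : z.im ≠ 0) (e : H) :
    T (Ring.inverse (T - z • ContinuousLinearMap.id ℂ H) e)
      - z • Ring.inverse (T - z • ContinuousLinearMap.id ℂ H) e = e :=
  congrArg (fun S : H →L[ℂ] H => S e) (Ring.mul_inverse_cancel _ (isUnit_sub_smul_id hT hz))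

theorem inverse_sub_smul_apply (hT : IsSelfAdjoint T) (hz : z.im ≠ 0) (u : H) :
    Ring.inverse (T - z • ContinuousLinearMap.id ℂ H) (T u - z • u) = u :=
  congrArg (fun S : H →L[ℂ] H => S u) (Ring.inverse_mul_cancel _ (isUnit_sub_smul_id hT hz))

theorem im_inner_inverse_self (hT : IsSelfAdjoint T) (hz : z.im ≠ 0) (e : H) :
    (inner ℂ e (Ring.inverse (T - z • ContinuousLinearMap.id ℂ H) e)).im
      = z.im * ‖Ring.inverse (T - z • ContinuousLinearMap.id ℂ H) e‖ ^ 2 := by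
  have hu := sub_smul_inverse_apply hT hz e
  set u := Ring.inverse (T - z • ContinuousLinearMap.id ℂ H) e
  have hreal : (inner ℂ (T u) u).im = 0 :=
    (congrArg Complex.im (hT.isSymmetric.coe_re_inner_apply_self u)).symm
  have hinner : inner ℂ e u = inner ℂ (T u) u - conj z * ((‖u‖ ^ 2 : ℝ) : ℂ) := by
    conv_lhs => rw [← hu]
    rw [inner_sub_left, inner_smul_left, inner_self_eq_norm_sq_to_K]
    push_cast
    rfl
  rw [hinner, Complex.sub_im, hreal, Complex.im_mul_ofReal, Complex.conj_im]
  ring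

theorem inverse_rankOne_apply (hT : IsSelfAdjoint T) (hT' : IsSelfAdjoint T') (hz : z.im ≠ 0)
    {e : H} {c : ℂ} (h : ∀ u, T' u = T u + (c * inner ℂ e u) • e) :
    Ring.inverse (T - z • ContinuousLinearMap.id ℂ H) e
      = (1 + c * inner ℂ e (Ring.inverse (T - z • ContinuousLinearMap.id ℂ H) e)) •
        Ring.inverse (T' - z • ContinuousLinearMap.id ℂ H) e := by
  have hu := sub_smul_inverse_apply hT hz e
  set u := Ring.inverse (T - z • ContinuousLinearMap.id ℂ H) e
  have hT'u : T' u - z • u = (1 + c * inner ℂ e u) • e := by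
    rw [h, add_sub_right_comm, hu, add_smul, one_smul]
  rw [← map_smul, ← hT'u, inverse_sub_smul_apply hT' hz]

theorem im_inner_inverse_self_pos (hT : IsSelfAdjoint T) (hz : 0 < z.im) {e : H} (he : e ≠ 0) :
    0 < (inner ℂ e (Ring.inverse (T - z • ContinuousLinearMap.id ℂ H) e)).im := by
  rw [im_inner_inverse_self hT hz.ne']
  have hu : Ring.inverse (T - z • ContinuousLinearMap.id ℂ H) e ≠ 0 := fun h0 => he <| by
    simpa [h0] using (sub_smul_inverse_apply hT hz.ne' e).symm
  positivity

/-- The point `w` is `-⟨e, (T - z)⁻¹ e⟩⁻¹`, and its imaginary part is governed by the Ward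
identity. -/
theorem exists_enorm_inner_inverse_rankOne (hT : IsSelfAdjoint T) (hz : 0 < z.im) {e f : H}
    (he : ‖e‖ = 1) (hf : ‖f‖ ≤ 1) :
    ∃ (w : ℂ) (R : ℝ≥0), z.im ≤ w.im ∧ z.im * R ^ 2 ≤ w.im ∧
      ∀ (t : ℝ) (T' : H →L[ℂ] H), IsSelfAdjoint T' → (∀ u, T' u = T u + (t * inner ℂ e u) • e) →
        ‖inner ℂ f (Ring.inverse (T' - z • ContinuousLinearMap.id ℂ H) e)‖ₑ
          = R * ‖((t : ℂ) - w)⁻¹‖ₑ := by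
  have hward := im_inner_inverse_self hT hz.ne' e
  have hG_im := im_inner_inverse_self_pos hT hz (norm_ne_zero_iff.1 (he ▸ one_ne_zero))
  have hrank := fun (t : ℝ) T' hT' h => inverse_rankOne_apply (T' := T') hT hT' hz.ne'
    (e := e) (c := (t : ℂ)) h
  set u := Ring.inverse (T - z • ContinuousLinearMap.id ℂ H) e
  set G := inner ℂ e u
  have hG : G ≠ 0 := fun h => hG_im.ne' (by simp [h])
  have hG_pos : 0 < ‖G‖ := norm_pos_iff.2 hG
  have hw_im : (-G⁻¹).im = z.im * (‖u‖ / ‖G‖) ^ 2 := by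
    rw [Complex.neg_im, Complex.inv_im, hward, Complex.normSq_eq_norm_sq]
    ring
  have hG_le : ‖G‖ ≤ ‖u‖ := by simpa [he] using norm_inner_le_norm (𝕜 := ℂ) e u
  have hfu_le : ‖inner ℂ f u‖ ≤ ‖u‖ :=
    (norm_inner_le_norm f u).trans (mul_le_of_le_one_left (norm_nonneg u) hf)
  have hw_le : z.im ≤ (-G⁻¹).im := by
    rw [hw_im]
    exact le_mul_of_one_le_right hz.le (one_le_pow₀ ((one_le_div hG_pos).2 hG_le))
  refine ⟨-G⁻¹, ‖inner ℂ f u‖₊ / ‖G‖₊, hw_le, ?_, fun t T' hT' h => ?_⟩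
  · rw [hw_im, NNReal.coe_div, coe_nnnorm, coe_nnnorm]
    gcongr
  · have hfac : 1 + t * G = G * (t - -G⁻¹) := by
      field_simp
      ring
    have hne : (t : ℂ) - -G⁻¹ ≠ 0 := ofReal_sub_ne_zero (hz.trans_le hw_le).ne' t
    have hfu : inner ℂ f (Ring.inverse (T' - z • ContinuousLinearMap.id ℂ H) e)
        = inner ℂ f u / G * ((t : ℂ) - -G⁻¹)⁻¹ := by
      rw [hrank t T' hT' h, inner_smul_right, hfac, mul_assoc, mul_div_cancel_left₀ _ hG,
        mul_comm, inv_mul_cancel_left₀ hne]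
    rw [hfu, enorm_mul, enorm_eq_nnnorm (inner ℂ f u / G), nnnorm_div]

end RankOne

section LatticeOperators

variable {d : ℕ}

theorem inner_basisVector_left (x : Fin d → ℤ) (u : LatticeL2 d) :
    inner ℂ (basisVector x) u = u x := by
  rw [basisVector, lp.inner_single_left]
  simp

theorem basisVector_apply (x n : Fin d → ℤ) :
    basisVector x n = if n = x then 1 else 0 := by
  rw [basisVector, lp.single_apply, Pi.single_apply]

theorem norm_basisVector (x : Fin d → ℤ) : ‖basisVector x‖ = 1 := by
  rw [basisVector, lp.norm_single (by norm_num), norm_one]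

theorem inner_shift_left (k : Fin d → ℤ) (u w : LatticeL2 d) :
    inner ℂ (shift k u) w = inner ℂ u (shift (-k) w) := by
  have hshift (k n : Fin d → ℤ) (u : LatticeL2 d) : shift k u n = u (n + k) := rfl
  rw [lp.inner_eq_tsum, lp.inner_eq_tsum,
    ← (Equiv.addRight k).tsum_eq fun n => inner ℂ (u n) (shift (-k) w n)]
  simp [hshift]

theorem neg_mem_unitVectors {k : Fin d → ℤ} (hk : k ∈ unitVectors d) : -k ∈ unitVectors d := by
  rw [mem_unitVectors] at hk ⊢
  simpa using hk

theorem isSelfAdjoint_discreteLaplacian (d : ℕ) : IsSelfAdjoint (discreteLaplacian d) := by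
  rw [ContinuousLinearMap.isSelfAdjoint_iff_isSymmetric]
  intro u w
  simp only [discreteLaplacian, ContinuousLinearMap.coe_coe, neg_apply, _root_.sum_apply,
    inner_neg_left, inner_neg_right, sum_inner, inner_sum, inner_shift_left]
  congr 1
  exact Finset.sum_nbij' (fun k => -k) (fun k => -k) (fun k hk => neg_mem_unitVectors hk)
    (fun k hk => neg_mem_unitVectors hk) (by simp) (by simp) (by simp)

theorem isSelfAdjoint_potentialOperator (v : (Fin d → ℤ) → ℝ) :
    IsSelfAdjoint (potentialOperator v) := by
  by_cases h : ∃ K : ℝ, 0 ≤ K ∧ ∀ n, |v n| ≤ K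
  · obtain ⟨K, -, hK⟩ := h
    rw [ContinuousLinearMap.isSelfAdjoint_iff_isSymmetric]
    intro u w
    simp only [ContinuousLinearMap.coe_coe, lp.inner_eq_tsum, potentialOperator_apply v hK]
    refine tsum_congr fun n => ?_
    simp only [RCLike.inner_apply, map_mul, Complex.conj_ofReal]
    ring
  · rw [potentialOperator, dif_neg h]
    exact IsSelfAdjoint.zero _

theorem isSelfAdjoint_andersonHamiltonian (v : (Fin d → ℤ) → ℝ) :
    IsSelfAdjoint (andersonHamiltonian v) :=
  (isSelfAdjoint_discreteLaplacian d).add (isSelfAdjoint_potentialOperator v)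

theorem weaklyMeasurable_potentialOperator :
    WeaklyMeasurable (potentialOperator : ((Fin d → ℤ) → ℝ) → LatticeL2 d →L[ℂ] LatticeL2 d) := by
  have hbdd : MeasurableSet {v : (Fin d → ℤ) → ℝ | ∃ K : ℝ, 0 ≤ K ∧ ∀ n, |v n| ≤ K} := by
    have hunion : {v : (Fin d → ℤ) → ℝ | ∃ K : ℝ, 0 ≤ K ∧ ∀ n, |v n| ≤ K}
        = ⋃ K : ℕ, ⋂ n, {v : (Fin d → ℤ) → ℝ | |v n| ≤ K} := by
      ext v
      simp only [Set.mem_ofPred_eq, Set.mem_iUnion, Set.mem_iInter]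
      refine ⟨fun ⟨K, _, hK⟩ => ?_, fun ⟨K, hK⟩ => ⟨K, K.cast_nonneg, hK⟩⟩
      obtain ⟨N, hN⟩ := exists_nat_ge K
      exact ⟨N, fun n => (hK n).trans hN⟩
    rw [hunion]
    exact .iUnion fun K => .iInter fun n => measurableSet_le (by fun_prop) measurable_const
  have hcoord (u : LatticeL2 d) (n) : Measurable fun v => potentialOperator v u n := by
    have hindicator : (fun v => potentialOperator v u n)
        = {v : (Fin d → ℤ) → ℝ | ∃ K : ℝ, 0 ≤ K ∧ ∀ n, |v n| ≤ K}.indicator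
          fun v => (v n : ℂ) * u n := by
      ext v
      by_cases h : v ∈ {v : (Fin d → ℤ) → ℝ | ∃ K : ℝ, 0 ≤ K ∧ ∀ n, |v n| ≤ K}
      · rw [Set.indicator_of_mem h]
        obtain ⟨K, -, hK⟩ := h
        exact potentialOperator_apply v hK u n
      · rw [Set.indicator_of_notMem h, show potentialOperator v = 0 from dif_neg h]
        rfl
    rw [hindicator]
    exact Measurable.indicator (by fun_prop) hbdd
  intro φ ψ
  refine measurable_of_tendsto_metrizable' atTop
    (f := fun s v => ∑ n ∈ s, inner ℂ (φ n) (potentialOperator v ψ n))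
    (fun s => Finset.measurable_fun_sum s fun n _ => measurable_const.inner (hcoord ψ n))
    (tendsto_pi_nhds.2 fun v => by
      simpa only [HasSum, SummationFilter.unconditional_filter] using
        lp.hasSum_inner φ (potentialOperator v ψ))

theorem weaklyMeasurable_andersonHamiltonian :
    WeaklyMeasurable
      (andersonHamiltonian : ((Fin d → ℤ) → ℝ) → LatticeL2 d →L[ℂ] LatticeL2 d) :=
  (WeaklyMeasurable.const (discreteLaplacian d)).add weaklyMeasurable_potentialOperator

theorem weaklyMeasurable_borelCalculus_andersonHamiltonian {g : ℝ → ℂ} {M : ℝ}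
    (hg : IsBoundedBorel g M) :
    WeaklyMeasurable fun v : (Fin d → ℤ) → ℝ => borelCalculus (andersonHamiltonian v) g :=
  weaklyMeasurable_andersonHamiltonian.borelCalculus ⟨.refl ℂ _⟩
    isSelfAdjoint_andersonHamiltonian hg

theorem potentialOperator_update_apply {v : (Fin d → ℤ) → ℝ} {A : ℝ} (hv : ∀ n, |v n| ≤ A)
    (x : Fin d → ℤ) (t : ℝ) (u : LatticeL2 d) :
    potentialOperator (Function.update v x t) u
      = potentialOperator (Function.update v x 0) u
        + (t * inner ℂ (basisVector x) u) • basisVector x := by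
  have hupdate (t : ℝ) (n : Fin d → ℤ) : |Function.update v x t n| ≤ max A |t| := by
    rcases eq_or_ne n x with rfl | hn
    · simp
    · simp [hn, hv n]
  ext n
  rw [lp.coeFn_add, lp.coeFn_smul, Pi.add_apply, Pi.smul_apply, basisVector_apply,
    inner_basisVector_left, potentialOperator_apply _ (hupdate t),
    potentialOperator_apply _ (hupdate 0)]
  rcases eq_or_ne n x with rfl | hn
  · simp
  · simp [hn]

theorem exists_enorm_greenFunction_update {v : (Fin d → ℤ) → ℝ} {A : ℝ} (hv : ∀ n, |v n| ≤ A)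
    (n x : Fin d → ℤ) {z : ℂ} (hz : 0 < z.im) :
    ∃ (w : ℂ) (R : ℝ≥0), z.im ≤ w.im ∧ z.im * R ^ 2 ≤ w.im ∧
      ∀ t : ℝ, ‖greenFunction (Function.update v x t) n x z‖ₑ = R * ‖((t : ℂ) - w)⁻¹‖ₑ := by
  obtain ⟨w, R, hw, hRw, hG⟩ := exists_enorm_inner_inverse_rankOne
    (isSelfAdjoint_andersonHamiltonian (Function.update v x 0)) hz (norm_basisVector x)
    (norm_basisVector n).le
  refine ⟨w, R, hw, hRw, fun t => hG t _ (isSelfAdjoint_andersonHamiltonian _) fun u => ?_⟩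
  simp only [andersonHamiltonian, _root_.add_apply, potentialOperator_update_apply hv x t u,
    add_assoc]

end LatticeOperators

section SingleSiteAverage

theorem lintegral_enorm_inv_sub_sq {w : ℂ} (hw : 0 < w.im) :
    ∫⁻ t : ℝ, ‖((t : ℂ) - w)⁻¹‖ₑ ^ 2 = ENNReal.ofReal (Real.pi / w.im) := by
  have hcauchy (t : ℝ) : ‖((t : ℂ) - w)⁻¹‖ₑ ^ 2
      = ENNReal.ofReal (Real.pi / w.im) * cauchyPDF w.re w.im.toNNReal t := by
    have hnorm : ‖(t : ℂ) - w‖ ^ 2 = (t - w.re) ^ 2 + w.im ^ 2 := by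
      rw [← Complex.normSq_eq_norm_sq, Complex.normSq_apply]
      simp
      ring
    rw [cauchyPDF_def, cauchyPDFReal_def, Real.coe_toNNReal _ hw.le,
      ← ENNReal.ofReal_mul (by positivity), ← ofReal_norm, ← ENNReal.ofReal_pow (norm_nonneg _),
      norm_inv, inv_pow, hnorm]
    congr 1
    field_simp
  simp only [hcauchy]
  rw [lintegral_const_mul _ (measurable_cauchyPDF _ _),
    lintegral_cauchyPDF_eq_one _ (by simpa using hw), mul_one]

theorem le_mul_rpow_of_le_of_le_mul_sq {q K B : ℝ≥0∞} {s : ℝ} (hs : s ∈ Set.Icc (0 : ℝ) 2)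
    (hq : q ≤ K) (hqB : q ≤ K * B ^ 2) : q ≤ K * B ^ s := by
  rcases le_total 1 B with hB | hB
  · exact hq.trans (le_mul_of_one_le_right' (by
      simpa using ENNReal.rpow_le_rpow hB hs.1))
  · rw [← ENNReal.rpow_two] at hqB
    exact hqB.trans (mul_le_mul_right (ENNReal.rpow_le_rpow_of_exponent_ge hB hs.2) K)

variable {ν : Measure ℝ} {M : ℝ≥0} {A : ℝ} {ε : ℝ} {w : ℂ} {R : ℝ≥0}

theorem coe_mul_enorm_inv (R : ℝ≥0) (ζ : ℂ) : R * ‖ζ⁻¹‖ₑ = ENNReal.ofReal (R / ‖ζ‖) := by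
  rw [div_eq_mul_inv, ENNReal.ofReal_mul R.coe_nonneg, ENNReal.ofReal_coe_nnreal, ← norm_inv,
    ofReal_norm]

theorem lintegral_sq_le_of_le_smul_volume (hν : ν ≤ M • volume) (hε : 0 ≤ ε) (hw : 0 < w.im) :
    ENNReal.ofReal ε * ∫⁻ t : ℝ, (R * ‖((t : ℂ) - w)⁻¹‖ₑ) ^ 2 ∂ν
      ≤ ENNReal.ofReal (M * Real.pi * (ε * R ^ 2 / w.im)) := by
  calc ENNReal.ofReal ε * ∫⁻ t : ℝ, (R * ‖((t : ℂ) - w)⁻¹‖ₑ) ^ 2 ∂ν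
      = ENNReal.ofReal ε * R ^ 2 * ∫⁻ t : ℝ, ‖((t : ℂ) - w)⁻¹‖ₑ ^ 2 ∂ν := by
        simp only [mul_pow]
        rw [lintegral_const_mul _ (by fun_prop), mul_assoc]
    _ ≤ ENNReal.ofReal ε * R ^ 2 * (M * ENNReal.ofReal (Real.pi / w.im)) := by
        gcongr
        refine (lintegral_mono' hν le_rfl).trans_eq ?_
        rw [lintegral_smul_measure, lintegral_enorm_inv_sub_sq hw]
        rfl
    _ = ENNReal.ofReal (M * Real.pi * (ε * R ^ 2 / w.im)) := by
        rw [← ENNReal.ofReal_coe_nnreal, ← ENNReal.ofReal_coe_nnreal (p := M),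
          ← ENNReal.ofReal_pow R.coe_nonneg, ← ENNReal.ofReal_mul hε,
          ← ENNReal.ofReal_mul M.coe_nonneg, ← ENNReal.ofReal_mul (by positivity)]
        congr 1
        ring

theorem lintegral_sq_le_mul_sq [IsProbabilityMeasure ν] (hν : ν ≤ M • volume)
    (hνA : ∀ᵐ t ∂ν, |t| ≤ A) (hε : 0 < ε) (hε1 : ε ≤ 1) (hw : ε ≤ w.im) :
    ENNReal.ofReal ε * ∫⁻ t : ℝ, (R * ‖((t : ℂ) - w)⁻¹‖ₑ) ^ 2 ∂ν
      ≤ ENNReal.ofReal (M * Real.pi * (9 * A ^ 2) + 9) * ENNReal.ofReal (R / (A + ‖w‖)) ^ 2 := by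
  have hw_im : 0 < w.im := hε.trans_le hw
  have hw_pos : 0 < ‖w‖ := hw_im.trans_le ((le_abs_self _).trans (Complex.abs_im_le_norm w))
  obtain ⟨t₀, ht₀⟩ := hνA.exists
  have hA : 0 ≤ A := (abs_nonneg t₀).trans ht₀
  rw [← ENNReal.ofReal_pow (by positivity), ← ENNReal.ofReal_mul (by positivity)]
  rcases le_or_gt ‖w‖ (2 * A) with hnear | hfar
  · refine (lintegral_sq_le_of_le_smul_volume hν hε.le hw_im).trans
      (ENNReal.ofReal_le_ofReal ?_)
    have hR : (R : ℝ) ≤ 3 * A * (R / (A + ‖w‖)) := by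
      rw [mul_div_assoc', le_div_iff₀ (by positivity), mul_comm]
      gcongr
      linarith
    calc M * Real.pi * (ε * R ^ 2 / w.im) ≤ M * Real.pi * R ^ 2 := by
          gcongr
          rw [div_le_iff₀ hw_im, mul_comm]
          gcongr
      _ ≤ M * Real.pi * (3 * A * (R / (A + ‖w‖))) ^ 2 := by gcongr
      _ = M * Real.pi * (9 * A ^ 2) * (R / (A + ‖w‖)) ^ 2 := by ring
      _ ≤ _ := by gcongr; exact le_add_of_nonneg_right (by norm_num)
  · have hpoint : ∀ᵐ t : ℝ ∂ν, ENNReal.ofReal ε * (R * ‖((t : ℂ) - w)⁻¹‖ₑ) ^ 2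
        ≤ ENNReal.ofReal (9 * (R / (A + ‖w‖)) ^ 2) := by
      filter_upwards [hνA] with t ht
      have hdist : (A + ‖w‖) / 3 ≤ ‖(t : ℂ) - w‖ := by
        have := norm_sub_norm_le w (t : ℂ)
        rw [Complex.norm_real, Real.norm_eq_abs, norm_sub_rev] at this
        linarith
      rw [coe_mul_enorm_inv, ← ENNReal.ofReal_pow (by positivity), ← ENNReal.ofReal_mul hε.le]
      refine ENNReal.ofReal_le_ofReal ?_
      calc ε * (R / ‖(t : ℂ) - w‖) ^ 2 ≤ 1 * (R / ((A + ‖w‖) / 3)) ^ 2 := by gcongr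
        _ = 9 * (R / (A + ‖w‖)) ^ 2 := by rw [div_div_eq_mul_div]; ring
    rw [← lintegral_const_mul' _ _ ENNReal.ofReal_ne_top]
    refine (lintegral_mono_ae hpoint).trans ?_
    rw [lintegral_const, measure_univ, mul_one]
    gcongr
    exact le_add_of_nonneg_left (by positivity)

theorem rpow_le_lintegral_rpow [IsProbabilityMeasure ν] (hνA : ∀ᵐ t ∂ν, |t| ≤ A)
    (hw : 0 < w.im) {s : ℝ} (hs : 0 ≤ s) :
    ENNReal.ofReal (R / (A + ‖w‖)) ^ s ≤ ∫⁻ t : ℝ, (R * ‖((t : ℂ) - w)⁻¹‖ₑ) ^ s ∂ν := by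
  calc ENNReal.ofReal (R / (A + ‖w‖)) ^ s
      = ∫⁻ _, ENNReal.ofReal (R / (A + ‖w‖)) ^ s ∂ν := by simp
    _ ≤ _ := lintegral_mono_ae <| by
      filter_upwards [hνA] with t ht
      have hdist : ‖(t : ℂ) - w‖ ≤ A + ‖w‖ :=
        (norm_sub_le _ _).trans (by rw [Complex.norm_real]; exact add_le_add_left ht _)
      have hdist_pos : 0 < ‖(t : ℂ) - w‖ := norm_pos_iff.2 (ofReal_sub_ne_zero hw.ne' t)
      rw [coe_mul_enorm_inv]
      gcongr

theorem lintegral_sq_le_lintegral_rpow [IsProbabilityMeasure ν] (hν : ν ≤ M • volume)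
    (hνA : ∀ᵐ t ∂ν, |t| ≤ A) {s : ℝ} (hs : s ∈ Set.Icc (0 : ℝ) 2) (hε : 0 < ε) (hε1 : ε ≤ 1)
    (hw : ε ≤ w.im) (hRw : ε * R ^ 2 ≤ w.im) :
    ENNReal.ofReal ε * ∫⁻ t : ℝ, (R * ‖((t : ℂ) - w)⁻¹‖ₑ) ^ 2 ∂ν
      ≤ ENNReal.ofReal (M * Real.pi * (1 + 9 * A ^ 2) + 9)
        * ∫⁻ t : ℝ, (R * ‖((t : ℂ) - w)⁻¹‖ₑ) ^ s ∂ν := by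
  have hw_im : 0 < w.im := hε.trans_le hw
  refine (le_mul_rpow_of_le_of_le_mul_sq hs
    ((lintegral_sq_le_of_le_smul_volume hν hε.le hw_im).trans ?_)
    ((lintegral_sq_le_mul_sq hν hνA hε hε1 hw).trans ?_)).trans
    (mul_le_mul_right (rpow_le_lintegral_rpow hνA hw_im hs.1) _)
  · refine ENNReal.ofReal_le_ofReal ?_
    have : ε * R ^ 2 / w.im ≤ 1 := (div_le_one hw_im).2 hRw
    calc M * Real.pi * (ε * R ^ 2 / w.im) ≤ M * Real.pi * (1 + 9 * A ^ 2) := by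
          gcongr
          exact this.trans (le_add_of_nonneg_right (by positivity))
      _ ≤ _ := le_add_of_nonneg_right (by norm_num)
  · gcongr
    exact le_add_of_nonneg_left zero_le_one

end SingleSiteAverage

section Resampling

variable {ι : Type*} [DecidableEq ι] {X : ι → Type*}

theorem preimage_update_pi_eq_prod (s : Set ι) (t : ∀ i, Set (X i)) (x : ι) :
    (fun p : (∀ i, X i) × X x => Function.update p.1 x p.2) ⁻¹' s.pi t
      = (s \ {x}).pi t ×ˢ {b | x ∈ s → b ∈ t x} := by
  ext p
  exact Set.update_mem_pi_iff

variable [∀ i, MeasurableSpace (X i)] (μ : (i : ι) → Measure (X i))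
  [∀ i, IsProbabilityMeasure (μ i)]

theorem map_update_infinitePi (x : ι) :
    ((Measure.infinitePi μ).prod (μ x)).map (fun p => Function.update p.1 x p.2)
      = Measure.infinitePi μ := by
  refine Measure.eq_infinitePi μ fun s t ht => ?_
  rw [Measure.map_apply measurable_update' (.pi s.countable_toSet fun i _ => ht i),
    preimage_update_pi_eq_prod, Measure.prod_prod, ← Finset.coe_singleton, ← Finset.coe_sdiff,
    Measure.infinitePi_pi μ fun i _ => ht i]
  by_cases hx : x ∈ s
  · simp [hx, Finset.sdiff_singleton_eq_erase,
      Finset.prod_erase_mul s (fun i => μ i (t i)) hx]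
  · simp [hx, Finset.sdiff_singleton_eq_erase]

theorem lintegral_infinitePi_eq_lintegral_update (x : ι) {F : (∀ i, X i) → ℝ≥0∞}
    (hF : Measurable F) :
    ∫⁻ v, F v ∂Measure.infinitePi μ
      = ∫⁻ v, ∫⁻ t, F (Function.update v x t) ∂μ x ∂Measure.infinitePi μ := by
  conv_lhs => rw [← map_update_infinitePi μ x, lintegral_map hF measurable_update']
  exact lintegral_prod _ (hF.comp measurable_update').aemeasurable

end Resampling

section LatticeSums

variable {d : ℕ}

theorem latticeDist_nonneg (x y : Fin d → ℤ) : 0 ≤ latticeDist x y :=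
  Finset.sum_nonneg fun _ _ => abs_nonneg _

theorem latticeDist_le_add (n x y : Fin d → ℤ) :
    latticeDist x y ≤ latticeDist n x + latticeDist n y := by
  simp only [latticeDist, ← Finset.sum_add_distrib]
  refine Finset.sum_le_sum fun i _ => ?_
  rw [abs_sub_comm (n i)]
  exact abs_sub_le (x i) (n i) (y i)

theorem summable_exp_neg_mul_abs_int {c : ℝ} (hc : 0 < c) :
    Summable fun k : ℤ => Real.exp (-c * |(k : ℝ)|) := by
  have hnat : Summable fun n : ℕ => Real.exp (-c * n) := by
    refine (summable_geometric_of_lt_one (Real.exp_pos (-c)).le (by simpa using hc)).congr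
      fun n => ?_
    rw [← Real.exp_nat_mul, mul_comm]
  exact .of_nat_of_neg (by simpa using hnat) (by simpa using hnat)

theorem tsum_exp_neg_mul_sum_abs_ne_top {c : ℝ} (hc : 0 < c) (d : ℕ) :
    ∑' k : Fin d → ℤ, ENNReal.ofReal (Real.exp (-c * ∑ i, |(k i : ℝ)|)) ≠ ⊤ := by
  induction d with
  | zero =>
    rw [tsum_eq_single (0 : Fin 0 → ℤ) fun b hb => absurd (Subsingleton.elim b 0) hb]
    exact ENNReal.ofReal_ne_top
  | succ d ih =>
    have hcons (p : ℤ × (Fin d → ℤ)) :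
        ENNReal.ofReal (Real.exp (-c * ∑ i,
          |((Fin.consEquiv (fun _ : Fin (d + 1) => ℤ) p i : ℤ) : ℝ)|))
        = ENNReal.ofReal (Real.exp (-c * |(p.1 : ℝ)|))
          * ENNReal.ofReal (Real.exp (-c * ∑ i, |(p.2 i : ℝ)|)) := by
      rw [← ENNReal.ofReal_mul (Real.exp_pos _).le, ← Real.exp_add, Fin.sum_univ_succ]
      simp [Fin.consEquiv, mul_add]
    rw [← (Fin.consEquiv fun _ : Fin (d + 1) => ℤ).tsum_eq, tsum_congr hcons,
      ENNReal.tsum_prod (f := fun (a : ℤ) (b : Fin d → ℤ) =>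
        ENNReal.ofReal (Real.exp (-c * |(a : ℝ)|))
          * ENNReal.ofReal (Real.exp (-c * ∑ i, |(b i : ℝ)|)))]
    simp only [ENNReal.tsum_mul_left, ENNReal.tsum_mul_right]
    exact ENNReal.mul_ne_top (summable_exp_neg_mul_abs_int hc).tsum_ofReal_ne_top ih

theorem tsum_exp_neg_mul_latticeDist (c : ℝ) (x : Fin d → ℤ) :
    ∑' n : Fin d → ℤ, ENNReal.ofReal (Real.exp (-c * latticeDist n x))
      = ∑' k : Fin d → ℤ, ENNReal.ofReal (Real.exp (-c * ∑ i, |(k i : ℝ)|)) := by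
  rw [← (Equiv.subRight x).tsum_eq fun k : Fin d → ℤ =>
    ENNReal.ofReal (Real.exp (-c * ∑ i, |(k i : ℝ)|))]
  refine tsum_congr fun n => ?_
  simp [latticeDist]

theorem lintegral_mul_le_of_lintegral_sq_le {α : Type*} [MeasurableSpace α] {μ : Measure α}
    {f g : α → ℝ≥0∞} (hf : AEMeasurable f μ) (hg : AEMeasurable g μ) {X Y : ℝ} (hX : 0 ≤ X)
    (hY : 0 ≤ Y) (hfX : ∫⁻ o, f o ^ 2 ∂μ ≤ ENNReal.ofReal X)
    (hgY : ∫⁻ o, g o ^ 2 ∂μ ≤ ENNReal.ofReal Y) :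
    ∫⁻ o, f o * g o ∂μ ≤ ENNReal.ofReal (√X * √Y) := by
  have h := ENNReal.lintegral_mul_le_Lp_mul_Lq μ Real.HolderConjugate.two_two hf hg
  simp only [ENNReal.rpow_two, Pi.mul_apply] at h
  refine h.trans ?_
  rw [ENNReal.ofReal_mul (Real.sqrt_nonneg X), Real.sqrt_eq_rpow, Real.sqrt_eq_rpow,
    ← ENNReal.ofReal_rpow_of_nonneg hX (by norm_num),
    ← ENNReal.ofReal_rpow_of_nonneg hY (by norm_num)]
  gcongr

theorem sqrt_mul_exp_mul_sqrt_mul_exp_le {D m p q r : ℝ} (hD : 0 ≤ D) (hm : 0 ≤ m)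
    (hq : 0 ≤ q) (hr : r ≤ p + q) :
    √(D * Real.exp (-m * p)) * √(D * Real.exp (-m * q))
      ≤ D * Real.exp (-(m / 4) * r) * Real.exp (-(m / 4) * p) := by
  have hsqrt (t : ℝ) : √(D * Real.exp t) = √D * Real.exp (t / 2) := by
    rw [Real.sqrt_mul hD, Real.exp_half]
  rw [hsqrt, hsqrt, mul_mul_mul_comm, Real.mul_self_sqrt hD, ← Real.exp_add, mul_assoc,
    ← Real.exp_add]
  refine mul_le_mul_of_nonneg_left (Real.exp_le_exp.2 ?_) hD
  nlinarith [mul_nonneg hm hq, mul_le_mul_of_nonneg_left hr hm]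

theorem lintegral_tsum_mul_le {α : Type*} [MeasurableSpace α] {μ : Measure α}
    {f g : (Fin d → ℤ) → α → ℝ≥0∞} (hf : ∀ n, AEMeasurable (f n) μ) (hg : ∀ n, AEMeasurable (g n) μ)
    {D m : ℝ} (hD : 0 ≤ D) (hm : 0 ≤ m) (x y : Fin d → ℤ)
    (hfD : ∀ n, ∫⁻ o, f n o ^ 2 ∂μ ≤ ENNReal.ofReal (D * Real.exp (-m * latticeDist n x)))
    (hgD : ∀ n, ∫⁻ o, g n o ^ 2 ∂μ ≤ ENNReal.ofReal (D * Real.exp (-m * latticeDist n y))) :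
    ∫⁻ o, ∑' n, f n o * g n o ∂μ
      ≤ ENNReal.ofReal (D * Real.exp (-(m / 4) * latticeDist x y))
        * ∑' k : Fin d → ℤ, ENNReal.ofReal (Real.exp (-(m / 4) * ∑ i, |(k i : ℝ)|)) := by
  rw [lintegral_tsum (f := fun n o => f n o * g n o) fun n => (hf n).mul (hg n),
    ← tsum_exp_neg_mul_latticeDist (m / 4) x, ← ENNReal.tsum_mul_left]
  refine ENNReal.tsum_le_tsum fun n => ?_
  rw [← ENNReal.ofReal_mul (by positivity)]
  refine (lintegral_mul_le_of_lintegral_sq_le (hf n) (hg n) (by positivity) (by positivity)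
    (hfD n) (hgD n)).trans
    (ENNReal.ofReal_le_ofReal (sqrt_mul_exp_mul_sqrt_mul_exp_le hD hm ?_ ?_))
  · exact_mod_cast latticeDist_nonneg n y
  · exact_mod_cast latticeDist_le_add n x y

end LatticeSums

section Measurability

variable {d : ℕ}

theorem measurable_greenFunction (x y : Fin d → ℤ) {z : ℂ} (hz : z.im ≠ 0) :
    Measurable fun v : (Fin d → ℤ) → ℝ => greenFunction v x y z := by
  simp only [greenFunction,
    fun v : (Fin d → ℤ) → ℝ => inverse_eq_borelCalculus (isSelfAdjoint_andersonHamiltonian v) hz]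
  exact weaklyMeasurable_borelCalculus_andersonHamiltonian (isBoundedBorel_inv_ofReal_sub hz) _ _

theorem continuous_greenFunction_line (v : (Fin d → ℤ) → ℝ) (x y : Fin d → ℤ) {γ : ℝ} (hγ : γ ≠ 0) :
    Continuous fun E : ℝ => greenFunction v x y (E + γ * Complex.I) := by
  have hz (E : ℝ) : (E + γ * Complex.I : ℂ).im ≠ 0 := by simpa using hγ
  simp only [greenFunction,
    fun E => inverse_eq_borelCalculus (isSelfAdjoint_andersonHamiltonian v) (hz E)]
  refine continuous_inner_borelCalculus (M := |γ|⁻¹) _ (fun E => ?_) (fun r => ?_) _ _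
  · simpa using isBoundedBorel_inv_ofReal_sub (hz E)
  · exact Continuous.inv₀ (by fun_prop) fun E => ofReal_sub_ne_zero (hz E) r

theorem measurable_uncurry_greenFunction_line (x y : Fin d → ℤ) {γ : ℝ} (hγ : γ ≠ 0) :
    Measurable fun p : ℝ × ((Fin d → ℤ) → ℝ) => greenFunction p.2 x y (p.1 + γ * Complex.I) :=
  measurable_uncurry_of_continuous_of_measurable
    (u := fun (E : ℝ) (v : (Fin d → ℤ) → ℝ) => greenFunction v x y (E + γ * Complex.I))
    (fun v => continuous_greenFunction_line v x y hγ)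
    fun E => measurable_greenFunction x y (by simpa using hγ)

variable {I : Set ℝ}

theorem isBoundedBorel_exp (t : ℝ) :
    IsBoundedBorel (fun r => Complex.exp (-Complex.I * t * r)) 1 where
  measurable := by fun_prop
  norm_le r := by simp [Complex.norm_exp]

theorem measurable_timeSupremum (hI : MeasurableSet I) (x y : Fin d → ℤ) :
    Measurable fun v : (Fin d → ℤ) → ℝ => timeSupremum v I x y := by
  have hg (t : ℝ) := (isBoundedBorel_exp t).mul (.indicator_one hI)
  simp only [timeSupremum, fun (v : (Fin d → ℤ) → ℝ) (t : ℝ) =>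
    borelCalculus_spectralProjection_apply (isSelfAdjoint_andersonHamiltonian v)
      (isBoundedBorel_exp t) hI (basisVector y)]
  exact measurable_iSup_of_continuous
    (fun t => (weaklyMeasurable_borelCalculus_andersonHamiltonian (hg t) _ _).enorm)
    fun v => (continuous_inner_borelCalculus _ hg (fun r => by fun_prop) _ _).enorm

theorem spectralVariation_eq_borelSupremum (hI : MeasurableSet I) (v : (Fin d → ℤ) → ℝ)
    (x y : Fin d → ℤ) : spectralVariation v I x y = borelSupremum v I x y :=
  variation_mixedSpectralMeasure (isSelfAdjoint_andersonHamiltonian v) _ _ hI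

theorem measurable_spectralVariation (hI : MeasurableSet I) (x y : Fin d → ℤ) :
    Measurable fun v : (Fin d → ℤ) → ℝ => spectralVariation v I x y :=
  weaklyMeasurable_andersonHamiltonian.measurable_variation ⟨.refl ℂ _⟩
    isSelfAdjoint_andersonHamiltonian hI _ _

theorem timeSupremum_le_spectralVariation (hI : MeasurableSet I) (v : (Fin d → ℤ) → ℝ)
    (x y : Fin d → ℤ) : timeSupremum v I x y ≤ spectralVariation v I x y := by
  rw [spectralVariation_eq_borelSupremum hI]
  exact iSup_le fun t => le_iSup_of_le
    ⟨_, (isBoundedBorel_exp t).measurable, (isBoundedBorel_exp t).norm_le⟩ le_rfl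

end Measurability

section SecondMoment

variable {d : ℕ} {ν : (Fin d → ℤ) → Measure ℝ} [∀ n, IsProbabilityMeasure (ν n)] {A : ℝ}

theorem ae_infinitePi_forall_abs_le (hνA : ∀ n, ∀ᵐ t ∂ν n, |t| ≤ A) :
    ∀ᵐ v ∂Measure.infinitePi ν, ∀ n, |v n| ≤ A := by
  refine ae_all_iff.2 fun n => ?_
  have hn := hνA n
  rw [← Measure.infinitePi_map_eval ν n] at hn
  exact ae_of_ae_map (measurable_pi_apply n).aemeasurable hn

theorem lintegral_greenFunction_sq_le {M : ℝ≥0} (hν : ∀ n, ν n ≤ M • volume)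
    (hνA : ∀ n, ∀ᵐ t ∂ν n, |t| ≤ A) {s : ℝ} (hs : s ∈ Set.Icc (0 : ℝ) 2) {z : ℂ} (hz : 0 < z.im)
    (hz1 : z.im ≤ 1) (n x : Fin d → ℤ) :
    ENNReal.ofReal z.im * ∫⁻ v, ‖greenFunction v n x z‖ₑ ^ 2 ∂Measure.infinitePi ν
      ≤ ENNReal.ofReal (M * Real.pi * (1 + 9 * A ^ 2) + 9)
        * ∫⁻ v, ‖greenFunction v n x z‖ₑ ^ s ∂Measure.infinitePi ν := by
  have hG := (measurable_greenFunction n x hz.ne').enorm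
  rw [lintegral_infinitePi_eq_lintegral_update ν x (hG.pow_const 2),
    lintegral_infinitePi_eq_lintegral_update ν x (hG.pow_const s),
    ← lintegral_const_mul' _ _ ENNReal.ofReal_ne_top,
    ← lintegral_const_mul' _ _ ENNReal.ofReal_ne_top]
  refine lintegral_mono_ae ?_
  filter_upwards [ae_infinitePi_forall_abs_le hνA] with v hv
  obtain ⟨w, R, hw, hRw, hGt⟩ := exists_enorm_greenFunction_update hv n x hz
  simp only [hGt]
  exact lintegral_sq_le_lintegral_rpow (hν x) (hνA x) hs hz hz1 hw hRw

end SecondMoment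

section EigenfunctionCorrelator

variable {d : ℕ}

theorem enorm_inner_inverse_le_tsum (v : (Fin d → ℤ) → ℝ) (x y : Fin d → ℤ) (z : ℂ) :
    ‖inner ℂ
        (Ring.inverse (andersonHamiltonian v - z • ContinuousLinearMap.id ℂ (LatticeL2 d))
          (basisVector x))
        (Ring.inverse (andersonHamiltonian v - z • ContinuousLinearMap.id ℂ (LatticeL2 d))
          (basisVector y))‖ₑ
      ≤ ∑' n, ‖greenFunction v n x z‖ₑ * ‖greenFunction v n y z‖ₑ := by
  rw [lp.inner_eq_tsum]
  refine enorm_tsum_le_tsum_enorm.trans_eq (tsum_congr fun n => ?_)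
  rw [greenFunction, greenFunction, inner_basisVector_left, inner_basisVector_left,
    RCLike.inner_apply, enorm_mul, RCLike.enorm_conj, mul_comm]

theorem spectralVariation_le_liminf {I : Set ℝ} (hI : IsOpen I) (hI_vol : volume I ≠ ⊤)
    (v : (Fin d → ℤ) → ℝ) (x y : Fin d → ℤ) :
    spectralVariation v I x y ≤ liminf (fun γ : ℝ≥0 => ∫⁻ E in I, γ * ∑' n,
      ‖greenFunction v n x (E + γ * Complex.I)‖ₑ * ‖greenFunction v n y (E + γ * Complex.I)‖ₑ)
      (𝓝[≠] 0) := by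
  refine (variation_mixedSpectralMeasure_le_liminf (isSelfAdjoint_andersonHamiltonian v) hI
    hI_vol _ _).trans (liminf_le_liminf (.of_forall fun γ => lintegral_mono fun E => ?_))
  have hγ : ‖((γ : ℝ) : ℂ)‖ₑ = γ := by
    rw [← ofReal_norm, Complex.norm_of_nonneg γ.coe_nonneg, ENNReal.ofReal_coe_nnreal]
  rw [enorm_mul, hγ]
  gcongr
  exact enorm_inner_inverse_le_tsum v x y _

theorem measurable_uncurry_tsum_greenFunction_mul (x y : Fin d → ℤ) (γ : ℝ≥0) :
    Measurable fun p : ℝ × ((Fin d → ℤ) → ℝ) => (γ : ℝ≥0∞) * ∑' n,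
      ‖greenFunction p.2 n x (p.1 + γ * Complex.I)‖ₑ
        * ‖greenFunction p.2 n y (p.1 + γ * Complex.I)‖ₑ := by
  rcases eq_or_ne γ 0 with rfl | hγ
  · simp
  · have hG (n z : Fin d → ℤ) :=
      (measurable_uncurry_greenFunction_line n z (NNReal.coe_ne_zero.2 hγ)).enorm
    exact (Measurable.tsum fun n => (hG n x).mul (hG n y)).const_mul _

variable {Q : Measure ((Fin d → ℤ) → ℝ)} {D m : ℝ}

theorem lintegral_tsum_greenFunction_mul_le (hD : 0 ≤ D) (hm : 0 ≤ m) {z : ℂ} {γ : ℝ≥0}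
    (hz : z.im ≠ 0)
    (hG : ∀ x y : Fin d → ℤ, γ * ∫⁻ v, ‖greenFunction v x y z‖ₑ ^ 2 ∂Q
      ≤ ENNReal.ofReal (D * Real.exp (-m * latticeDist x y)))
    (x y : Fin d → ℤ) :
    ∫⁻ v, γ * ∑' n, ‖greenFunction v n x z‖ₑ * ‖greenFunction v n y z‖ₑ ∂Q
      ≤ ENNReal.ofReal (D * Real.exp (-(m / 4) * latticeDist x y))
        * ∑' k : Fin d → ℤ, ENNReal.ofReal (Real.exp (-(m / 4) * ∑ i, |(k i : ℝ)|)) := by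
  have hG_meas (n k : Fin d → ℤ) : Measurable fun v => ‖greenFunction v n k z‖ₑ :=
    (measurable_greenFunction n k hz).enorm
  have hQ (n k : Fin d → ℤ) : ∫⁻ v, ‖greenFunction v n k z‖ₑ ^ 2 ∂(γ : ℝ≥0∞) • Q
      ≤ ENNReal.ofReal (D * Real.exp (-m * latticeDist n k)) := by
    simpa only [lintegral_smul_measure, smul_eq_mul] using hG n k
  rw [lintegral_const_mul' _ _ ENNReal.coe_ne_top, ← smul_eq_mul, ← lintegral_smul_measure]
  exact lintegral_tsum_mul_le (fun n => (hG_meas n x).aemeasurable)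
    (fun n => (hG_meas n y).aemeasurable) hD hm x y (fun n => hQ n x) fun n => hQ n y

theorem lintegral_spectralVariation_le [SFinite Q] {I : Set ℝ} (hI : IsOpen I)
    (hI_vol : volume I ≠ ⊤) (hD : 0 ≤ D) (hm : 0 ≤ m)
    (hG : ∀ x y : Fin d → ℤ, ∀ E ∈ I, ∀ γ : ℝ≥0, 0 < γ → γ ≤ 1 →
      γ * ∫⁻ v, ‖greenFunction v x y (E + γ * Complex.I)‖ₑ ^ 2 ∂Q
        ≤ ENNReal.ofReal (D * Real.exp (-m * latticeDist x y)))
    (x y : Fin d → ℤ) :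
    ∫⁻ v, spectralVariation v I x y ∂Q
      ≤ ENNReal.ofReal (D * Real.exp (-(m / 4) * latticeDist x y))
        * (∑' k : Fin d → ℤ, ENNReal.ofReal (Real.exp (-(m / 4) * ∑ i, |(k i : ℝ)|)))
        * volume I := by
  have hJ := measurable_uncurry_tsum_greenFunction_mul x y
  refine (lintegral_mono fun v => spectralVariation_le_liminf hI hI_vol v x y).trans
    ((lintegral_liminf_le fun γ => ((hJ γ).comp measurable_swap).lintegral_prod_right').trans
      (liminf_le_of_frequently_le' (Eventually.frequently ?_)))
  have hγ_le : ∀ᶠ γ : ℝ≥0 in 𝓝[≠] 0, γ ≤ 1 :=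
    nhdsWithin_le_nhds (Iic_mem_nhds zero_lt_one)
  filter_upwards [hγ_le, self_mem_nhdsWithin] with γ hγ1 hγ0
  refine le_of_eq_of_le
    (lintegral_lintegral_swap ((hJ γ).comp measurable_swap).aemeasurable) ?_
  rw [← setLIntegral_const]
  refine setLIntegral_mono measurable_const fun E hE => ?_
  exact lintegral_tsum_greenFunction_mul_le hD hm (by simpa using hγ0)
    (fun x y => hG x y E hE γ (pos_iff_ne_zero.2 hγ0) hγ1) x y

end EigenfunctionCorrelator

section Localization

variable {d : ℕ}

theorem exists_lintegral_spectralVariation_le {ν : (Fin d → ℤ) → Measure ℝ}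
    [∀ n, IsProbabilityMeasure (ν n)] {M : ℝ≥0} (hν : ∀ n, ν n ≤ M • volume) {A : ℝ}
    (hνA : ∀ n, ∀ᵐ t ∂ν n, |t| ≤ A) {I : Set ℝ} (hI : IsOpen I) (hI_vol : volume I ≠ ⊤)
    {s : ℝ} (hs : s ∈ Set.Icc (0 : ℝ) 2) {C m : ℝ} (hm : 0 < m)
    (hG : ∀ x y : Fin d → ℤ, ∀ E ∈ I, ∀ ε : ℝ, 0 < ε → ε ≤ 1 →
      ∫⁻ v, ‖greenFunction v x y (E + ε * Complex.I)‖ₑ ^ s ∂Measure.infinitePi ν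
        ≤ ENNReal.ofReal (C * Real.exp (-m * latticeDist x y))) :
    ∃ C' : ℝ, ∀ x y : Fin d → ℤ, ∫⁻ v, spectralVariation v I x y ∂Measure.infinitePi ν
      ≤ ENNReal.ofReal (C' * Real.exp (-(m / 4) * latticeDist x y)) := by
  let K : ℝ := M * Real.pi * (1 + 9 * A ^ 2) + 9
  let S : ℝ≥0∞ := ∑' k : Fin d → ℤ, ENNReal.ofReal (Real.exp (-(m / 4) * ∑ i, |(k i : ℝ)|))
  have hK : 0 ≤ K := by positivity
  have hS : S ≠ ⊤ := tsum_exp_neg_mul_sum_abs_ne_top (by positivity) d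
  have hG_sq (x y : Fin d → ℤ) (E : ℝ) (hE : E ∈ I) (γ : ℝ≥0) (hγ : 0 < γ) (hγ1 : γ ≤ 1) :
      γ * ∫⁻ v, ‖greenFunction v x y (E + γ * Complex.I)‖ₑ ^ 2 ∂Measure.infinitePi ν
        ≤ ENNReal.ofReal (K * |C| * Real.exp (-m * latticeDist x y)) := by
    have h := lintegral_greenFunction_sq_le hν hνA hs (z := E + γ * Complex.I)
      (by simpa using hγ) (by simpa using hγ1) x y
    rw [show (E + γ * Complex.I : ℂ).im = γ by simp, ENNReal.ofReal_coe_nnreal] at h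
    rw [mul_assoc, ENNReal.ofReal_mul hK]
    refine h.trans (mul_le_mul_right ((hG x y E hE γ hγ hγ1).trans ?_) _)
    gcongr
    exact le_abs_self C
  refine ⟨K * |C| * (S * volume I).toReal, fun x y => ?_⟩
  refine (lintegral_spectralVariation_le hI hI_vol (by positivity) hm.le hG_sq x y).trans_eq ?_
  rw [mul_right_comm _ (S * volume I).toReal, ENNReal.ofReal_mul' ENNReal.toReal_nonneg,
    ENNReal.ofReal_toReal (ENNReal.mul_ne_top hS hI_vol), mul_assoc]

theorem withDensity_ofReal_le_smul {α : Type*} [MeasurableSpace α] (μ : Measure α) {ρ : α → ℝ}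
    {M : ℝ} (hρ : ∀ a, ρ a ≤ M) :
    μ.withDensity (fun a => ENNReal.ofReal (ρ a)) ≤ M.toNNReal • μ := by
  rw [← Measure.coe_nnreal_smul, ← withDensity_const]
  exact withDensity_mono (.of_forall fun a => ENNReal.ofReal_le_ofReal (hρ a))

theorem exists_forall_ae_norm_le_of_hasCompactSupport {E : Type*} [NormedAddCommGroup E]
    [MeasurableSpace E] (μ : Measure E) {ρ : E → ℝ} (hρ_meas : Measurable ρ)
    (hρ : HasCompactSupport ρ) :
    ∃ A : ℝ, ∀ᵐ t ∂μ.withDensity (fun t => ENNReal.ofReal (ρ t)), ‖t‖ ≤ A := by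
  obtain ⟨A, hA⟩ := hρ.isCompact.isBounded.exists_norm_le
  refine ⟨A, (ae_withDensity_iff (by fun_prop)).2 (.of_forall fun t ht => hA t ?_)⟩
  exact subset_tsupport ρ fun h => ht (by simp [h])

end Localization

theorem theorem5p1_general {d : ℕ} {Ω : Type*} [MeasurableSpace Ω] (P : Measure Ω)
    [IsProbabilityMeasure P] (ω : (Fin d → ℤ) → Ω → ℝ) (hω_meas : ∀ n, Measurable (ω n))
    (hω_indep : iIndepFun ω P) {M : ℝ≥0} (hω_law : ∀ n, P.map (ω n) ≤ M • volume)
    {A : ℝ} (hω_bdd : ∀ n, ∀ᵐ t ∂P.map (ω n), |t| ≤ A)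
    {I : Set ℝ} (hI : IsOpen I) (hI_vol : volume I ≠ ⊤)
    {s : ℝ} (hs : s ∈ Set.Icc (0 : ℝ) 2) {C m : ℝ} (hm : 0 < m)
    (hG : ∀ x y : Fin d → ℤ, ∀ E ∈ I, ∀ ε : ℝ, 0 < ε → ε ≤ 1 →
      ∫⁻ o, ‖greenFunction (fun n => ω n o) x y (E + ε * Complex.I)‖ₑ ^ s ∂P
        ≤ ENNReal.ofReal (C * Real.exp (-m * latticeDist x y))) :
    DynamicalLocalization P ω I ∧
    (ExponentialDecay P fun x y o => spectralVariation (fun n => ω n o) I x y) ∧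
    (∀ x y : Fin d → ℤ, AEMeasurable (fun o => borelSupremum (fun n => ω n o) I x y) P ∧
      ∫⁻ o, spectralVariation (fun n => ω n o) I x y ∂P
        = ∫⁻ o, borelSupremum (fun n => ω n o) I x y ∂P) := by
  have hω : Measurable fun o n => ω n o := measurable_pi_lambda _ hω_meas
  have hP (F : ((Fin d → ℤ) → ℝ) → ℝ≥0∞) (hF : Measurable F) :
      ∫⁻ v, F v ∂Measure.infinitePi (fun n => P.map (ω n)) = ∫⁻ o, F (fun n => ω n o) ∂P := by
    rw [← hω_indep.map_fun_eq_infinitePi_map hω_meas, lintegral_map hF hω]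
  have hω_prob (n : Fin d → ℤ) : IsProbabilityMeasure (P.map (ω n)) :=
    Measure.isProbabilityMeasure_map (hω_meas n).aemeasurable
  obtain ⟨C', hC'⟩ := exists_lintegral_spectralVariation_le hω_law hω_bdd hI hI_vol hs hm
    fun x y E hE ε hε hε1 => by
      rw [hP _ ((measurable_greenFunction x y (by simpa using hε.ne')).enorm.pow_const s)]
      exact hG x y E hE ε hε hε1
  have hV_meas (x y : Fin d → ℤ) : Measurable fun o => spectralVariation (fun n => ω n o) I x y :=
    (measurable_spectralVariation hI.measurableSet x y).comp hω
  have hV_le (x y : Fin d → ℤ) : ∫⁻ o, spectralVariation (fun n => ω n o) I x y ∂P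
      ≤ ENNReal.ofReal (C' * Real.exp (-(m / 4) * latticeDist x y)) := by
    rw [← hP _ (measurable_spectralVariation hI.measurableSet x y)]
    exact hC' x y
  refine ⟨⟨C', m / 4, by positivity, fun x y => ⟨?_, ?_⟩⟩,
    ⟨C', m / 4, by positivity, fun x y => ⟨(hV_meas x y).aemeasurable, hV_le x y⟩⟩, fun x y => ?_⟩
  · exact ((measurable_timeSupremum hI.measurableSet x y).comp hω).aemeasurable
  · exact (lintegral_mono fun o => timeSupremum_le_spectralVariation hI.measurableSet _ x y).trans
      (hV_le x y)
  · simp only [← spectralVariation_eq_borelSupremum hI.measurableSet]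
    exact ⟨(hV_meas x y).aemeasurable, trivial⟩

end

theorem theorem5p1 {d : ℕ} {Ω : Type*} [MeasurableSpace Ω] (P : Measure Ω) [IsProbabilityMeasure P]
    (ω : (Fin d → ℤ) → Ω → ℝ) (hω_meas : ∀ n, Measurable (ω n)) (hω_indep : iIndepFun ω P)
    (ρ : ℝ → ℝ) (hρ_meas : Measurable ρ) (hρ_nonneg : ∀ v, 0 ≤ ρ v)
    (hρ_bdd : ∃ M, ∀ v, ρ v ≤ M) (hρ_supp : HasCompactSupport ρ)
    (hω_law : ∀ n, P.map (ω n) = volume.withDensity fun v => ENNReal.ofReal (ρ v))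
    (a b : ℝ) (s : ℝ) (hs : s ∈ Set.Ioo (0 : ℝ) 1) (C m : ℝ) (hm : 0 < m)
    (hG : ∀ x y : Fin d → ℤ, ∀ E ∈ Set.Ioo a b, ∀ ε : ℝ, 0 < ε →
      ∫⁻ o, ‖greenFunction (fun n => ω n o) x y (E + ε * Complex.I)‖ₑ ^ s ∂P
        ≤ ENNReal.ofReal (C * Real.exp (-m * latticeDist x y))) :
    DynamicalLocalization P ω (Set.Ioo a b) ∧
    (ExponentialDecay P fun x y o => spectralVariation (fun n => ω n o) (Set.Ioo a b) x y) ∧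
    (∀ x y : Fin d → ℤ, AEMeasurable (fun o => borelSupremum (fun n => ω n o) (Set.Ioo a b) x y) P ∧
      ∫⁻ o, spectralVariation (fun n => ω n o) (Set.Ioo a b) x y ∂P
        = ∫⁻ o, borelSupremum (fun n => ω n o) (Set.Ioo a b) x y ∂P) := by
  obtain ⟨M, hM⟩ := hρ_bdd
  obtain ⟨A, hA⟩ := exists_forall_ae_norm_le_of_hasCompactSupport volume hρ_meas hρ_supp
  exact theorem5p1_general P ω hω_meas hω_indep
    (fun n => (hω_law n).trans_le (withDensity_ofReal_le_smul volume hM))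
    (fun n => (hω_law n).symm ▸ hA) isOpen_Ioo measure_Ioo_lt_top.ne
    ⟨hs.1.le, hs.2.le.trans one_le_two⟩ hm fun x y E hE ε hε _ => hG x y E hE ε hε
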